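/- Let $\Gamma$ be a family of continuous, piecewise monotone maps $g:[0,1]\to[0,1]$ (for each $g$ there are finitely many points $0=t_0<t_1<\dots<t_n=1$ such that $g$ is non-decreasing or non-increasing on every $[t_i,t_{i+1}]$), equipped with the topology of uniform convergence and its Borel $\sigma$-algebra, and let $\mu$ be a Borel probability measure on $\Gamma$ with $\operatorname{supp}\mu=\Gamma$. Assume: (i) (condition $(\mathfrak A)$) for every $x\in(0,1]$ there is $g\in\Gamma$ with $g(0)=0$ and $g(x)\in(0,x)$, and for every $x\in[0,1)$ there is $h\in\Gamma$ with $h(1)=1$ and $h(x)\in(x,1)$; (ii) ($\mu$-injectivity) $\int_\Gamma n(g,x)\,d\mu(g)\le 1$ for every $x\in[0,1]$, where $n(g,x)\in\{0,1,2,\dots\}\cup\{\infty\}$ is the number of elements of $g^{-1}(\{x\})$; (iii) the system is below the diagonal on the left, i.e. $\mu(\{g\in\Gamma:\exists\,\epsilon>0\ \forall x\in(0,\epsilon)\cap[0,1]\ \ g(x)<x\})>0$, or above the diagonal on the right, i.e. $\mu(\{g\in\Gamma:\exists\,\epsilon>0\ \forall x\in(1-\epsilon,1)\cap[0,1]\ \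 g(x)>x\})>0$. Let $\nu$ be a Borel probability measure on $[0,1]$ that is $\mu$-invariant, i.e. $\nu(A)=\int_\Gamma\nu(g^{-1}(A))\,d\mu(g)$ for every Borel set $A\subseteq[0,1]$. Then $\nu$ is $\mu$-proximal: there is a measurable map $\Theta:\Gamma^{\mathbb N}\to[0,1]$ such that for $\mu^{\otimes\mathbb N}$-almost every $\omega=(g_1,g_2,\dots)\in\Gamma^{\mathbb N}$ the measures $\nu\circ(g_1\circ\cdots\circ g_n)^{-1}$ converge weakly, as $n\to\infty$, to a limit $\nu_\omega$, and $\nu_\omega=\delta_{\Theta(\omega)}$. -/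

import Mathlib

open Set Filter MeasureTheory
open scoped unitInterval Topology ENNReal

namespace IntervalSystem

/-- A map `g : [0,1] → [0,1]` is piecewise monotone (with finitely many pieces): there is a partition
`0 = t₀ < t₁ < ⋯ < tₙ = 1` such that on every `[tᵢ, tᵢ₊₁]` the map is non-decreasing or
non-increasing. -/
def PiecewiseMonotone (g : I → I) : Prop :=
  ∃ (n : ℕ) (t : Fin (n + 1) → I), StrictMono t ∧ t 0 = 0 ∧ t (Fin.last n) = 1 ∧
    ∀ i : Fin n, MonotoneOn g (Icc (t i.castSucc) (t i.succ)) ∨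
      AntitoneOn g (Icc (t i.castSucc) (t i.succ))

/-- The condition `(𝔄)` on a family `Γ` of continuous self-maps of `[0,1]`. -/
def ConditionA (Γ : Set C(I, I)) : Prop :=
  (∀ x ∈ Ioc (0 : I) 1, ∃ g ∈ Γ, g 0 = 0 ∧ g x ∈ Ioo 0 x) ∧
    (∀ x ∈ Ico (0 : I) 1, ∃ h ∈ Γ, h 1 = 1 ∧ h x ∈ Ioo x 1)

variable {Γ : Set C(I, I)} [MeasurableSpace Γ]

/-- `(Γ, μ)` is below the diagonal on the left. -/
def BelowDiagonalLeft (μ : Measure Γ) : Prop :=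
  0 < μ {g : Γ | ∃ ε : ℝ, 0 < ε ∧ ∀ x : I, (x : ℝ) ∈ Ioo 0 ε → g.1 x < x}

/-- `(Γ, μ)` is above the diagonal on the right. -/
def AboveDiagonalRight (μ : Measure Γ) : Prop :=
  0 < μ {g : Γ | ∃ ε : ℝ, 0 < ε ∧ ∀ x : I, (x : ℝ) ∈ Ioo (1 - ε) 1 → x < g.1 x}

/-- The number of elements (possibly infinite) of the fibre `g⁻¹(x)`. -/
noncomputable def preimageCount (g : C(I, I)) (x : I) : ℕ∞ :=
  (g ⁻¹' {x}).encard

/-- `(Γ, μ)` is `μ`-injective: `∫ n(g, x) dμ(g) ≤ 1` for every `x ∈ [0,1]`. -/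
def IsMuInjective (μ : Measure Γ) : Prop :=
  ∀ x : I, ∫⁻ g : Γ, (preimageCount g.1 x : ℝ≥0∞) ∂μ ≤ 1

/-- `ν` is `μ`-invariant: `ν(A) = ∫ ν(g⁻¹ A) dμ(g)` for every Borel set `A ⊆ [0,1]`. -/
def IsInvariant (μ : Measure Γ) (ν : Measure I) : Prop :=
  ∀ A : Set I, MeasurableSet A → ν A = ∫⁻ g : Γ, ν (g.1 ⁻¹' A) ∂μ

/-- The composition `g₁ ∘ ⋯ ∘ gₙ` of the first `n` entries of `ω = (g₁, g₂, …)`, where `gₖ` is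
`ω (k - 1)`; it is the identity for `n = 0`. -/
def rightWalk {Γ : Set C(I, I)} (ω : ℕ → Γ) : ℕ → C(I, I)
  | 0 => ContinuousMap.id I
  | n + 1 => (rightWalk ω n).comp (ω n).1

/-- The image measure `ν ∘ (g₁ ∘ ⋯ ∘ gₙ)⁻¹`. -/
noncomputable def walkImage {Γ : Set C(I, I)} (ν : ProbabilityMeasure I) (ω : ℕ → Γ) (n : ℕ) :
    ProbabilityMeasure I :=
  ν.map (rightWalk ω n).continuous.aemeasurable

/-- `η` is the Furstenberg limit `ν_ω`, i.e. the weak limit of `ν ∘ (g₁ ∘ ⋯ ∘ gₙ)⁻¹`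
(`ProbabilityMeasure` carries the topology of weak convergence, which is Hausdorff, so there is at
most one such `η`). -/
def IsFurstenbergLimit {Γ : Set C(I, I)} (ν : ProbabilityMeasure I) (ω : ℕ → Γ)
    (η : ProbabilityMeasure I) : Prop :=
  Tendsto (walkImage ν ω) atTop (𝓝 η)

/-- `ν` is `μ`-proximal: there is a measurable `Θ : Γ^ℕ → [0,1]` such that for almost every `ω`
with respect to the infinite product `μ^{⊗ℕ}` the limit `ν_ω` exists and is the Dirac mass
at `Θ(ω)`. -/
def IsProximal (μ : Measure Γ) (ν : ProbabilityMeasure I) : Prop :=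
  ∃ Θ : (ℕ → Γ) → I, Measurable Θ ∧
    ∀ᵐ ω ∂(Measure.infinitePi fun _ : ℕ => μ), IsFurstenbergLimit ν ω (diracProba (Θ ω))

end IntervalSystem

set_option linter.unusedSectionVars false

namespace IntervalSystem

/-! The argument measures non-proximality by the variance `vr ν A = ν(A)(1 - ν(A))` of pulled-back
sets. By invariance, `ν(w⁻¹A)` is a martingale along the random composition `w = g₁ ∘ ⋯ ∘ gₙ`. If
the mean variance of every `(x, 1]` tends to `0`, each limit is `0` or `1`; the tails at a dense
sequence of points then force convergence to a Dirac mass (`ae_tendsto_zero_or_one`,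
`tendsto_diracProba_iSup`).

First, `ν` has no atoms: injectivity and invariance make the finite set of heaviest atoms invariant,
while `(𝔄)` pushes its least positive point further down. Hence variances of sets with finitely many
switches depend continuously on the switches.

Suppose the mean variance of `(x, 1]` stays above `δ > 0`. Up to finite sets and complements, its
preimage switches only at preimages of `x`, whose mean number is at most `1`. With high probability
there are at most `K` of them, and compactness of `I^K` yields a rigid set: a nontrivial set whose
mean variance never drops (`exists_rigid`).

Take the least number `k` of switches of such a set. Preimages of a minimal rigid set need at least
`k` switches but have at most `k` on average, so almost surely exactly `k`
(`RigidSwitches.ae_preimage`). A proper subset of the switches can be missed entirely by the image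
of some word, since otherwise it would generate a rigid set with fewer switches
(`RigidSwitches.exists_not_ae_nonempty`). The intermediate value theorem then shows that the first
switch of one minimal rigid set lies to the left of all later switches of any other with the same
variance (`lt_of_mem_rigidTuples`).

Finally, choose a rigid set with rightmost first switch `a`, and a map near some `g` with `g 0 = 0`,
`g a < a`. The preimage has exactly one switch in `[0, a)`, but the map can only touch `a` there
without crossing it, so nothing switches: contradiction (`Rigid.vr_eq_zero`). -/

/-- The points having an odd number of the `y i`, `i ∈ s`, strictly to their left. -/
def alt {ι : Type*} (s : Finset ι) (y : ι → I) : Set I :=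
  {x | Odd (s.filter fun i => y i < x).card}

/-- Off `F`, the set `A` coincides with `B` or with its complement. -/
def EqOff (F : Finset I) (A B : Set I) : Prop :=
  (∀ x ∉ F, x ∈ A ↔ x ∈ B) ∨ (∀ x ∉ F, x ∈ A ↔ x ∉ B)

/-! ### Sets with finitely many switches and their preimages -/

section Alternating

variable {ι : Type*}

@[simp] lemma alt_empty (y : ι → I) : alt ∅ y = ∅ := by
  ext x; simp [alt]

lemma mem_alt_union [DecidableEq ι] {s t : Finset ι} (h : Disjoint s t) (y : ι → I) (x : I) :
    x ∈ alt (s ∪ t) y ↔ ¬(x ∈ alt s y ↔ x ∈ alt t y) := by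
  simp only [alt, mem_ofPred_eq, Finset.filter_union]
  rw [Finset.card_union_of_disjoint (Finset.disjoint_filter_filter h), Nat.odd_add]
  rw [← Nat.not_odd_iff_even]; tauto

lemma mem_alt_singleton (i : ι) (y : ι → I) (x : I) : x ∈ alt {i} y ↔ y i < x := by
  simp only [alt, mem_ofPred_eq, Finset.filter_singleton]
  split_ifs with h <;> simp [h]

lemma mem_alt_insert [DecidableEq ι] {s : Finset ι} {i : ι} (h : i ∉ s) (y : ι → I) (x : I) :
    x ∈ alt (insert i s) y ↔ ¬(y i < x ↔ x ∈ alt s y) := by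
  rw [Finset.insert_eq, mem_alt_union (by simpa using h), mem_alt_singleton]

lemma alt_image {s : Finset ι} {y : ι → I} (h : Set.InjOn y s) :
    alt (s.image y) id = alt s y := by
  ext x
  simp only [alt, mem_ofPred_eq, id]
  rw [Finset.filter_image, Finset.card_image_of_injOn
    (h.mono fun i hi => (Finset.mem_filter.1 hi).1)]

/-- Coinciding switches cancel in pairs, so passing to a limit of tuples can only lower the number
of switches. -/
lemma exists_finset_alt_eq (s : Finset ι) (y : ι → I) :
    ∃ Y : Finset I, Y ⊆ s.image y ∧ Y.card ≤ s.card ∧ alt Y id = alt s y := by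
  classical
  induction s using Finset.induction_on with
  | empty => exact ⟨∅, by simp⟩
  | insert i s hi ih =>
    obtain ⟨Y, hY, hc, he⟩ := ih
    rw [Finset.card_insert_of_notMem hi, Finset.image_insert]
    by_cases hm : y i ∈ Y
    · refine ⟨Y.erase (y i), (Finset.erase_subset _ _).trans
        (hY.trans (Finset.subset_insert _ _)), (Finset.card_erase_le).trans (by omega), ?_⟩
      ext x
      rw [mem_alt_insert hi, ← he]
      have := mem_alt_insert (Finset.notMem_erase (y i) Y) id x
      rw [Finset.insert_erase hm] at this
      simp only [id] at this
      tauto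
    · refine ⟨insert (y i) Y, Finset.insert_subset_insert _ hY, ?_, ?_⟩
      · rw [Finset.card_insert_of_notMem hm]; omega
      · ext x
        rw [mem_alt_insert hi, ← he, mem_alt_insert hm]; rfl

lemma measurableSet_alt (s : Finset ι) (y : ι → I) : MeasurableSet (alt s y) := by
  classical
  induction s using Finset.induction_on with
  | empty => simp
  | insert i s hi ih =>
    have : alt (insert i s) y = symmDiff (Ioi (y i)) (alt s y) := by
      ext x
      rw [mem_alt_insert hi, Set.mem_symmDiff, mem_Ioi]; tauto
    rw [this]
    exact measurableSet_Ioi.symmDiff ih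

lemma notMem_alt_of_forall_le {s : Finset ι} {y : ι → I} {x : I} (h : ∀ i ∈ s, x ≤ y i) :
    x ∉ alt s y := by
  simp only [alt, mem_ofPred_eq]
  rw [Finset.filter_false_of_mem fun i hi => not_lt.2 (h i hi)]
  simp

/-- A set whose indicator is constant on every interval that avoids a finite set `F` is, off `F`,
one of the sets `alt Y id` with `Y ⊆ F`, or the complement of such a set. -/
lemma exists_alt_of_const_off (F : Finset I) (B : Set I)
    (hB : ∀ a b, a ≤ b → (∀ z ∈ F, ¬(a ≤ z ∧ z ≤ b)) → (a ∈ B ↔ b ∈ B)) :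
    ∃ Y ⊆ F, EqOff F B (alt Y id) := by
  classical
  induction F using Finset.induction_on_max generalizing B with
  | empty =>
    refine ⟨∅, le_rfl, ?_⟩
    by_cases h : (0 : I) ∈ B
    · right; intro x _
      simpa [h] using hB 0 x unitInterval.nonneg' (by simp)
    · left; intro x _
      simpa [h] using hB 0 x unitInterval.nonneg' (by simp)
  | insert p F hp ih =>
    have hpF : p ∉ F := fun h => lt_irrefl _ (hp p h)
    obtain ⟨S, hS⟩ : ∃ S : Prop, ∀ z, z < p → (∀ w ∈ F, w < z) → (z ∈ B ↔ S) := by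
      by_cases hz : ∃ z, z < p ∧ ∀ w ∈ F, w < z
      · obtain ⟨z, hz1, hz2⟩ := hz
        refine ⟨z ∈ B, fun z' h1 h2 => ?_⟩
        rcases le_total z z' with h | h
        · exact (hB z z' h (by
            intro w hw
            rcases Finset.mem_insert.1 hw with rfl | hw
            · exact fun hh => absurd h1 (not_lt.2 hh.2)
            · exact fun hh => absurd (hz2 w hw) (not_lt.2 hh.1))).symm
        · exact hB z' z h (by
            intro w hw
            rcases Finset.mem_insert.1 hw with rfl | hw
            · exact fun hh => absurd hz1 (not_lt.2 hh.2)
            · exact fun hh => absurd (h2 w hw) (not_lt.2 hh.1))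
      · exact ⟨True, fun z h1 h2 => absurd ⟨z, h1, h2⟩ hz⟩
    obtain ⟨T, hT⟩ : ∃ T : Prop, ∀ z, p < z → (z ∈ B ↔ T) := by
      refine ⟨(1 : I) ∈ B, fun z hz => hB z 1 unitInterval.le_one' ?_⟩
      intro w hw
      rcases Finset.mem_insert.1 hw with rfl | hw
      · exact fun hh => absurd hz (not_lt.2 hh.1)
      · exact fun hh => absurd ((hp w hw).trans hz) (not_lt.2 hh.1)
    -- `S` and `T` are the constant values of `B` just left and right of `p`. `B1` erases the
    -- possible switch at `p` by continuing `S` to the right; the switch is real exactly when `S`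
    -- and `T` differ. If there is no room to the left of `p`, the value of `S` is immaterial.
    let B1 : Set I := {x | (x < p ∧ x ∈ B) ∨ (p ≤ x ∧ S)}
    have hB1lt : ∀ x, x < p → (x ∈ B1 ↔ x ∈ B) := fun x hx => by simp [B1, hx]
    have hB1ge : ∀ x, p ≤ x → (x ∈ B1 ↔ S) := fun x hx => by simp [B1, hx, not_lt.2 hx]
    obtain ⟨Y, hYF, hY⟩ := ih B1 (by
      intro a b hab hF
      rcases lt_or_ge b p with hb | hb
      · rw [hB1lt b hb, hB1lt a (hab.trans_lt hb)]
        refine hB a b hab ?_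
        intro w hw
        rcases Finset.mem_insert.1 hw with rfl | hw
        · exact fun hh => absurd hb (not_lt.2 hh.2)
        · exact hF w hw
      · rw [hB1ge b hb]
        rcases lt_or_ge a p with ha | ha
        · rw [hB1lt a ha]
          refine hS a ha fun w hw => ?_
          by_contra hwa
          exact hF w hw ⟨not_lt.1 hwa, (hp w hw).le.trans hb⟩
        · rw [hB1ge a ha])
    have hpY : p ∉ Y := fun h => hpF (hYF h)
    by_cases hST : S ↔ T
    · refine ⟨Y, hYF.trans (Finset.subset_insert _ _), ?_⟩
      have key : ∀ x ∉ insert p F, x ∉ F ∧ (x ∈ B ↔ x ∈ B1) := by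
        intro x hx
        rw [Finset.mem_insert, not_or] at hx
        refine ⟨hx.2, ?_⟩
        rcases lt_or_gt_of_ne hx.1 with h | h
        · exact (hB1lt x h).symm
        · rw [hB1ge x h.le, hT x h, hST]
      rcases hY with hY | hY
      · exact Or.inl fun x hx => (key x hx).2.trans (hY x (key x hx).1)
      · exact Or.inr fun x hx => (key x hx).2.trans (hY x (key x hx).1)
    · refine ⟨insert p Y, Finset.insert_subset_insert _ hYF, ?_⟩
      have key : ∀ x ∉ insert p F, x ∉ F ∧ (x ∈ B ↔ ¬(p < x ↔ x ∈ B1)) := by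
        intro x hx
        rw [Finset.mem_insert, not_or] at hx
        refine ⟨hx.2, ?_⟩
        rcases lt_or_gt_of_ne hx.1 with h | h
        · rw [hB1lt x h]; simp [not_lt.2 h.le]
        · rw [hB1ge x h.le, hT x h]; simp [h]; tauto
      rcases hY with hY | hY
      · refine Or.inl fun x hx => ?_
        rw [(key x hx).2, hY x (key x hx).1, mem_alt_insert hpY]; rfl
      · refine Or.inr fun x hx => ?_
        rw [(key x hx).2, hY x (key x hx).1, mem_alt_insert hpY]; simp only [id]; tauto

/-- The image of an interval free of `F` is connected and avoids `Y`, so it stays between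
neighbouring switches. The complement in `EqOff` is unavoidable because `alt` never contains `0`. -/
lemma exists_preimage_alt (f : C(I, I)) (Y F : Finset I) (hF : ∀ x, f x ∈ Y → x ∈ F) :
    ∃ Y' ⊆ F, EqOff F (f ⁻¹' alt Y id) (alt Y' id) := by
  refine exists_alt_of_const_off F _ fun a b hab hz => ?_
  have hav : ∀ z ∈ Y, z ∉ f '' Icc a b := by
    rintro z hzY ⟨x, hx, rfl⟩
    exact hz x (hF x hzY) hx
  have hconn : (f '' Icc a b).OrdConnected :=
    (isPreconnected_Icc.image f f.continuous.continuousOn).ordConnected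
  have ha : f a ∈ f '' Icc a b := mem_image_of_mem _ ⟨le_rfl, hab⟩
  have hb : f b ∈ f '' Icc a b := mem_image_of_mem _ ⟨hab, le_rfl⟩
  have : (Y.filter fun i => id i < f a) = Y.filter fun i => id i < f b := by
    refine Finset.filter_congr fun z hzY => ?_
    simp only [id]
    constructor
    · intro h
      by_contra h'
      exact hav z hzY (hconn.out hb ha ⟨not_lt.1 h', h.le⟩)
    · intro h
      by_contra h'
      exact hav z hzY (hconn.out ha hb ⟨not_lt.1 h', h.le⟩)
  simp only [mem_preimage, alt, mem_ofPred_eq]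
  rw [this]

end Alternating

/-! ### Counting preimages -/

section Counting

/-- Expresses a cardinality bound through countably many choices of disjoint basic open sets, which
makes the fibre count measurable in the map. -/
lemma le_encard_iff_exists_basis (S : Set I) (n : ℕ) :
    (n : ℕ∞) ≤ S.encard ↔ ∃ t : Fin n → TopologicalSpace.countableBasis I,
      Pairwise (fun i j => Disjoint (t i : Set I) (t j)) ∧ ∀ i, ∃ y ∈ (t i : Set I), y ∈ S := by
  constructor
  · intro h
    obtain ⟨T, hTS, hT⟩ := Set.exists_subset_encard_eq h
    have hTf : T.Finite := Set.finite_of_encard_eq_coe hT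
    obtain ⟨U, hU, hd⟩ := hTf.t2_separation
    have hb : ∀ y : I, ∃ V : TopologicalSpace.countableBasis I, y ∈ (V : Set I) ∧ (V : Set I) ⊆ U y := by
      intro y
      obtain ⟨V, hV, hyV, hVU⟩ := (TopologicalSpace.isBasis_countableBasis I).exists_subset_of_mem_open
        (hU y).1 (hU y).2
      exact ⟨⟨V, hV⟩, hyV, hVU⟩
    choose V hyV hVU using hb
    have hTn : T.ncard = n := by rw [Set.ncard_def, hT]; simp
    obtain ⟨e⟩ : Nonempty (Fin n ≃ T) := by
      have := hTf.fintype
      refine ⟨(Fintype.equivFinOfCardEq ?_).symm⟩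
      rw [← Nat.card_eq_fintype_card, Nat.card_coe_set_eq, hTn]
    refine ⟨fun i => V (e i), fun i j hij => ?_, fun i => ⟨e i, hyV _, hTS (e i).2⟩⟩
    refine (hd (e i).2 (e j).2 ?_).mono (hVU _) (hVU _)
    exact fun h => hij (e.injective (Subtype.ext h))
  · rintro ⟨t, hd, h⟩
    choose y hyt hyS using h
    have hinj : Function.Injective y := by
      intro i j hij
      by_contra hne
      exact Set.disjoint_left.1 (hd hne) (hyt i) (hij ▸ hyt j)
    calc (n : ℕ∞) = (range y).encard := by
          rw [← Set.image_univ, hinj.encard_image, Set.encard_univ]; simp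
      _ ≤ S.encard := Set.encard_le_encard (range_subset_iff.2 hyS)

lemma encard_preimage_finset (g : C(I, I)) (Y : Finset I) :
    ((g ⁻¹' (Y : Set I)).encard : ℝ≥0∞) = ∑ y ∈ Y, (preimageCount g y : ℝ≥0∞) := by
  classical
  induction Y using Finset.induction_on with
  | empty => simp
  | insert y Y hy ih =>
    rw [Finset.sum_insert hy, ← ih, Finset.coe_insert, Set.insert_eq, preimage_union,
      encard_union_eq, preimageCount, ENat.toENNReal_add]
    exact Disjoint.preimage _ (by simpa using hy)

end Counting

/-! ### Measurability in the uniform topology -/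

section Measurability

variable [MeasurableSpace C(I, I)] [BorelSpace C(I, I)]

lemma measurable_comp_prod : Measurable fun p : C(I, I) × C(I, I) => p.1.comp p.2 :=
  (continuous_fst.compCM continuous_snd).measurable

lemma measurable_apply_prod : Measurable fun p : C(I, I) × I => p.1 p.2 :=
  (continuous_eval (F := C(I, I))).measurable

lemma measurable_measure_preimage (ν : Measure I) [SFinite ν] {A : Set I} (hA : MeasurableSet A) :
    Measurable fun w : C(I, I) => ν (w ⁻¹' A) :=
  measurable_measure_prodMk_left (measurable_apply_prod hA)

/-- `U` is a countable union of compact sets, and avoiding `x` on a compact set is an open condition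
on `g`. -/
lemma measurableSet_exists_mem_eq {U : Set I} (hU : IsOpen U) (x : I) :
    MeasurableSet {g : C(I, I) | ∃ y ∈ U, g y = x} := by
  obtain ⟨F, hF, -, hFU, -⟩ := hU.exists_iUnion_isClosed
  have : {g : C(I, I) | ∃ y ∈ U, g y = x} = ⋃ n, {g : C(I, I) | MapsTo g (F n) {x}ᶜ}ᶜ := by
    ext g
    simp only [← hFU, mem_ofPred_eq, mem_iUnion, mem_compl_iff, MapsTo, mem_singleton_iff, not_forall,
      not_not, exists_prop]
    constructor
    · rintro ⟨y, ⟨n, hn⟩, hy⟩; exact ⟨n, y, hn, hy⟩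
    · rintro ⟨n, y, hn, hy⟩; exact ⟨y, ⟨n, hn⟩, hy⟩
  rw [this]
  exact MeasurableSet.iUnion fun n =>
    ((ContinuousMap.isOpen_setOfPred_mapsTo (hF n).isCompact isOpen_compl_singleton).measurableSet).compl

lemma measurableSet_le_encard_preimage (n : ℕ) (x : I) :
    MeasurableSet {g : C(I, I) | (n : ℕ∞) ≤ (g ⁻¹' {x}).encard} := by
  have : {g : C(I, I) | (n : ℕ∞) ≤ (g ⁻¹' {x}).encard} =
      ⋃ t : Fin n → TopologicalSpace.countableBasis I,
        ⋃ (_ : Pairwise (fun i j => Disjoint (t i : Set I) (t j))),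
          ⋂ i, {g : C(I, I) | ∃ y ∈ (t i : Set I), g y = x} := by
    ext g
    simp only [mem_ofPred_eq, le_encard_iff_exists_basis, mem_iUnion, mem_iInter, mem_preimage,
      mem_singleton_iff, exists_prop]
  rw [this]
  have : Countable (TopologicalSpace.countableBasis I) :=
    (TopologicalSpace.countable_countableBasis I).to_subtype
  refine MeasurableSet.iUnion fun t => MeasurableSet.iUnion fun _ => MeasurableSet.iInter fun i =>
    measurableSet_exists_mem_eq ?_ x
  exact (TopologicalSpace.isBasis_countableBasis I).isOpen (t i).2

lemma measurable_preimageCount (x : I) :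
    Measurable fun g : C(I, I) => (preimageCount g x : ℝ≥0∞) := by
  have key : Measurable fun g : C(I, I) => preimageCount g x := by
    refine measurable_to_countable' fun k => ?_
    induction k using ENat.recTopCoe with
    | top =>
      have : (fun g : C(I, I) => preimageCount g x) ⁻¹' {⊤} =
          ⋂ n : ℕ, {g : C(I, I) | (n : ℕ∞) ≤ (g ⁻¹' {x}).encard} := by
        ext g
        simp only [mem_preimage, mem_singleton_iff, preimageCount, mem_iInter, mem_ofPred_eq]
        rw [ENat.eq_top_iff_forall_ge]
      rw [this]
      exact MeasurableSet.iInter fun n => measurableSet_le_encard_preimage n x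
    | coe k =>
      have : (fun g : C(I, I) => preimageCount g x) ⁻¹' {(k : ℕ∞)} =
          {g : C(I, I) | (k : ℕ∞) ≤ (g ⁻¹' {x}).encard} \
            {g : C(I, I) | ((k + 1 : ℕ) : ℕ∞) ≤ (g ⁻¹' {x}).encard} := by
        ext g
        simp only [mem_preimage, mem_singleton_iff, preimageCount, Set.mem_sdiff, mem_ofPred_eq]
        rw [Nat.cast_add, Nat.cast_one, ENat.add_one_le_iff (by simp), not_lt]
        exact ⟨fun h => ⟨h.ge, h.le⟩, fun h => le_antisymm h.2 h.1⟩
      rw [this]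
      exact (measurableSet_le_encard_preimage k x).diff (measurableSet_le_encard_preimage _ x)
  exact (Measurable.of_discrete (f := fun k : ℕ∞ => (k : ℝ≥0∞))).comp key

lemma measurable_encard_preimage_finset (Y : Finset I) :
    Measurable fun g : C(I, I) => ((g ⁻¹' (Y : Set I)).encard : ℝ≥0∞) := by
  simp only [encard_preimage_finset]
  exact Finset.measurable_sum _ fun y _ => measurable_preimageCount y

end Measurability

/-! ### Laws of random compositions -/

section Words

variable [MeasurableSpace C(I, I)]

/-- The law of the composition of `n` independent maps with law `m`. -/
noncomputable def compLaw (m : Measure C(I, I)) : ℕ → Measure C(I, I)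
  | 0 => Measure.dirac (ContinuousMap.id I)
  | n + 1 => ((compLaw m n).prod m).map fun p => p.1.comp p.2

/-- On average a point has at most one preimage. -/
def LawInjective (m : Measure C(I, I)) : Prop :=
  ∀ x : I, ∫⁻ g, (preimageCount g x : ℝ≥0∞) ∂m ≤ 1

/-- Invariance of `ν` for a law on all continuous maps. -/
def LawInvariant (m : Measure C(I, I)) (ν : Measure I) : Prop :=
  ∀ A : Set I, MeasurableSet A → ν A = ∫⁻ g, ν (g ⁻¹' A) ∂m

variable [BorelSpace C(I, I)]

lemma LawInjective.lintegral_encard_le {m : Measure C(I, I)} (h : LawInjective m) (B : Set I) :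
    ∫⁻ g, ((g ⁻¹' B).encard : ℝ≥0∞) ∂m ≤ (B.encard : ℝ≥0∞) := by
  by_cases hB : B.Finite
  · obtain ⟨Y, rfl⟩ := hB.exists_finset_coe
    simp only [encard_preimage_finset]
    rw [lintegral_finsetSum _ fun y _ => measurable_preimageCount y]
    calc _ ≤ ∑ y ∈ Y, (1 : ℝ≥0∞) := Finset.sum_le_sum fun y _ => h y
      _ = _ := by simp [Set.encard_coe_eq_coe_finsetCard]
  · rw [Set.not_finite.1 hB |>.encard_eq]; simp

variable (m : Measure C(I, I)) [IsProbabilityMeasure m]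

instance isProbabilityMeasure_compLaw (n : ℕ) : IsProbabilityMeasure (compLaw m n) := by
  induction n with
  | zero => simp only [compLaw]; infer_instance
  | succ n ih => exact Measure.isProbabilityMeasure_map measurable_comp_prod.aemeasurable

lemma lintegral_map_comp (a b : Measure C(I, I)) [SFinite b] {φ : C(I, I) → ℝ≥0∞}
    (hφ : Measurable φ) :
    ∫⁻ w, φ w ∂((a.prod b).map fun p => p.1.comp p.2) = ∫⁻ f, ∫⁻ g, φ (f.comp g) ∂b ∂a := by
  rw [lintegral_map hφ measurable_comp_prod]
  exact lintegral_prod _ (hφ.comp measurable_comp_prod).aemeasurable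

lemma measurable_lintegral_comp (b : Measure C(I, I)) [SFinite b] {φ : C(I, I) → ℝ≥0∞}
    (hφ : Measurable φ) : Measurable fun f : C(I, I) => ∫⁻ g, φ (f.comp g) ∂b :=
  (hφ.comp measurable_comp_prod).lintegral_prod_right'

/-- Associativity of composition lets a random word be split at any place into independent outer and
inner parts. -/
lemma compLaw_add (a b : ℕ) :
    compLaw m (a + b) = ((compLaw m a).prod (compLaw m b)).map fun p => p.1.comp p.2 := by
  refine Measure.ext_of_lintegral _ fun φ hφ => ?_
  rw [lintegral_map_comp _ _ hφ]
  induction b generalizing φ with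
  | zero =>
    simp only [compLaw, add_zero]
    refine lintegral_congr fun f => ?_
    rw [lintegral_dirac' _ (by exact hφ.comp (measurable_comp_prod.comp measurable_prodMk_left))]
    simp
  | succ b ih =>
    rw [← add_assoc]
    simp only [compLaw]
    rw [lintegral_map_comp _ _ hφ, ih _ (measurable_lintegral_comp m hφ)]
    refine lintegral_congr fun f => ?_
    rw [lintegral_map_comp _ _ (by
      exact hφ.comp (measurable_comp_prod.comp measurable_prodMk_left))]
    rfl

lemma integral_compLaw_add (a b : ℕ) {φ : C(I, I) → ℝ} (hφ : Measurable φ) {C : ℝ}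
    (hC : ∀ w, ‖φ w‖ ≤ C) :
    ∫ w, φ w ∂compLaw m (a + b) = ∫ f, ∫ g, φ (f.comp g) ∂compLaw m b ∂compLaw m a := by
  rw [compLaw_add, integral_map measurable_comp_prod.aemeasurable hφ.aestronglyMeasurable,
    integral_prod]
  exact Integrable.of_bound (hφ.comp measurable_comp_prod).aestronglyMeasurable C
    (ae_of_all _ fun p => hC _)

lemma ae_ae_of_ae_compLaw_add {a b : ℕ} {p : C(I, I) → Prop}
    (h : ∀ᵐ w ∂compLaw m (a + b), p w) :
    ∀ᵐ f ∂compLaw m a, ∀ᵐ g ∂compLaw m b, p (f.comp g) := by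
  rw [compLaw_add] at h
  exact Measure.ae_ae_of_ae_prod (ae_of_ae_map measurable_comp_prod.aemeasurable h)

variable {m}

lemma LawInvariant.compLaw {ν : Measure I} [SFinite ν] (h : LawInvariant m ν) (n : ℕ) :
    LawInvariant (compLaw m n) ν := by
  induction n with
  | zero =>
    intro A hA
    simp only [IntervalSystem.compLaw]
    rw [lintegral_dirac' _ (measurable_measure_preimage ν hA)]
    simp
  | succ n ih =>
    intro A hA
    simp only [IntervalSystem.compLaw]
    rw [lintegral_map_comp _ _ (measurable_measure_preimage ν hA), ih A hA]
    refine lintegral_congr fun f => ?_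
    rw [h _ (f.continuous.measurable hA)]
    rfl

/-- The fibre of `f ∘ g` is the `g`-preimage of a fibre of `f`, and taking `g`-preimages does not
increase cardinality on average. -/
lemma LawInjective.compLaw (h : LawInjective m) (n : ℕ) : LawInjective (compLaw m n) := by
  induction n with
  | zero =>
    intro x
    simp only [IntervalSystem.compLaw]
    rw [lintegral_dirac' _ (measurable_preimageCount x)]
    simp [preimageCount]
  | succ n ih =>
    intro x
    simp only [IntervalSystem.compLaw]
    rw [lintegral_map_comp _ _ (measurable_preimageCount x)]
    refine (lintegral_mono fun f => ?_).trans (ih x)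
    exact h.lintegral_encard_le (f ⁻¹' {x})

end Words

/-! ### Absence of atoms -/

section Atoms

/-- Replaces a specific map of the support by a nearby one that enjoys an almost sure property. -/
lemma exists_mem_of_mem_support {X : Type*} [TopologicalSpace X] [MeasurableSpace X]
    {m : Measure X} {g : X} (hg : g ∈ m.support) {U : Set X} (hU : IsOpen U) (hgU : g ∈ U)
    {p : X → Prop} (hp : ∀ᵐ w ∂m, p w) : ∃ w ∈ U, p w := by
  have h := (Measure.mem_support_iff_forall g).1 hg U (hU.mem_nhds hgU)
  by_contra! hcon
  refine h.ne' (measure_mono_null (fun w hw => ?_) hp)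
  exact hcon w hw

lemma measure_finset_le {ν : Measure I} {M : ℝ≥0∞} (hM : ∀ x, ν {x} ≤ M) (S : Finset I) :
    ν S ≤ M * S.card := by
  calc ν S = ∑ y ∈ S, ν {y} := by rw [sum_measure_singleton]
    _ ≤ ∑ y ∈ S, M := Finset.sum_le_sum fun y _ => hM y
    _ = M * S.card := by simp [mul_comm]

lemma measure_singleton_eq_of_measure_finset_eq {ν : Measure I} {M : ℝ≥0∞} (hMt : M ≠ ∞)
    (hM : ∀ x, ν {x} ≤ M) {S : Finset I} (hS : ν S = M * S.card) {y : I} (hy : y ∈ S) :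
    ν {y} = M := by
  classical
  refine le_antisymm (hM y) ?_
  have h1 : ν S ≤ ν {y} + M * (S.erase y).card := by
    calc ν S = ν ({y} ∪ (S.erase y : Finset I)) := by
          rw [← Set.insert_eq, ← Finset.coe_insert, Finset.insert_erase hy]
      _ ≤ ν {y} + ν (S.erase y : Finset I) := measure_union_le _ _
      _ ≤ _ := by gcongr; exact measure_finset_le hM _
  rw [hS, ← Finset.card_erase_add_one hy, Nat.cast_add, Nat.cast_one, mul_add, mul_one,
    add_comm] at h1
  exact ENNReal.le_of_add_le_add_right
    (ENNReal.mul_ne_top hMt (ENNReal.natCast_ne_top _)) h1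

variable [MeasurableSpace C(I, I)] [BorelSpace C(I, I)] {m : Measure C(I, I)}

/-- With `F` the points of maximal mass `M`, one has `ν(g⁻¹F) ≤ M · #g⁻¹F`, while the mean of the
left side is `M · #F` and that of the right side is at most this. Equality almost surely means that
all preimages have mass `M`, so `g⁻¹F ⊆ F`; comparing means again gives equality. -/
lemma LawInvariant.ae_preimage_eq [IsProbabilityMeasure m] {ν : Measure I}
    [IsProbabilityMeasure ν] (hinj : LawInjective m)
    (hinv : LawInvariant m ν) {M : ℝ≥0∞} (hM0 : M ≠ 0) (hM : ∀ x, ν {x} ≤ M) {F : Finset I}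
    (hF : ∀ x, x ∈ F ↔ ν {x} = M) (hne : F.Nonempty) : ∀ᵐ g : C(I, I) ∂m, g ⁻¹' (F : Set I) = F := by
  have hMt : M ≠ ∞ := by
    obtain ⟨x, hx⟩ := hne
    rw [← (hF x).1 hx]; exact measure_ne_top _ _
  have hνF : ν (F : Set I) = M * F.card := by
    rw [← sum_measure_singleton, Finset.sum_congr rfl fun x hx => (hF x).1 hx]
    simp [mul_comm]
  have hle : ∀ g : C(I, I), ν (g ⁻¹' (F : Set I)) ≤ M * ((g ⁻¹' (F : Set I)).encard : ℝ≥0∞) := by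
    intro g
    by_cases hfin : (g ⁻¹' (F : Set I)).Finite
    · obtain ⟨S, hS⟩ := hfin.exists_finset_coe
      rw [← hS, Set.encard_coe_eq_coe_finsetCard]
      simpa using measure_finset_le hM S
    · rw [Set.not_finite.1 hfin |>.encard_eq]
      simp [hM0]
  have hint : ∫⁻ g, M * ((g ⁻¹' (F : Set I)).encard : ℝ≥0∞) ∂m ≤ ∫⁻ g, ν (g ⁻¹' (F : Set I)) ∂m := by
    rw [← hinv F F.measurableSet, hνF, lintegral_const_mul _ (measurable_encard_preimage_finset F)]
    gcongr
    simpa [Set.encard_coe_eq_coe_finsetCard] using hinj.lintegral_encard_le (F : Set I)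
  have hfint : ∫⁻ g, ν (g ⁻¹' (F : Set I)) ∂m ≠ ∞ := by
    rw [← hinv F F.measurableSet]; exact measure_ne_top _ _
  have h1 := ae_eq_of_ae_le_of_lintegral_le (ae_of_all m hle) hfint
    ((measurable_encard_preimage_finset F).const_mul M).aemeasurable hint
  have hsub : ∀ᵐ g : C(I, I) ∂m, g ⁻¹' (F : Set I) ⊆ F := by
    filter_upwards [h1] with g hg y hy
    have hfin : (g ⁻¹' (F : Set I)).Finite := by
      by_contra hfin
      rw [Set.not_finite.1 hfin |>.encard_eq] at hg
      simp [hM0] at hg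
    obtain ⟨S, hS⟩ := hfin.exists_finset_coe
    rw [← hS, Set.encard_coe_eq_coe_finsetCard] at hg
    rw [← hS] at hy
    exact (hF y).2 (measure_singleton_eq_of_measure_finset_eq hMt hM (by simpa using hg) hy)
  have h2 : (fun g : C(I, I) => ν (g ⁻¹' (F : Set I))) =ᵐ[m] fun _ => ν F := by
    refine ae_eq_of_ae_le_of_lintegral_le (hsub.mono fun g hg => measure_mono hg) hfint
      aemeasurable_const ?_
    rw [← hinv F F.measurableSet]; simp
  filter_upwards [hsub, h2] with g hg1 hg2
  refine hg1.antisymm fun x hx => ?_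
  by_contra hxg
  have hnull : ν ((F : Set I) \ g ⁻¹' (F : Set I)) = 0 := by
    rw [measure_sdiff hg1 (g.continuous.measurable F.measurableSet).nullMeasurableSet
      (measure_ne_top _ _), hg2, tsub_self]
  have : ν {x} = 0 := measure_mono_null (t := (F : Set I) \ g ⁻¹' (F : Set I)) (singleton_subset_iff.2 ⟨hx, hxg⟩) hnull
  rw [(hF x).1 hx] at this
  exact hM0 this

/-- The heaviest atoms form a finite set preserved by every map in the support. It contains a
positive point because `0` can be moved, and its least positive point can be moved strictly lower
while staying positive. -/
lemma LawInvariant.measure_singleton_eq_zero [IsProbabilityMeasure m] {ν : Measure I}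
    [IsProbabilityMeasure ν] (hinj : LawInjective m) (hinv : LawInvariant m ν)
    (hleft : ∀ x : I, 0 < x → ∃ g ∈ m.support, 0 < g x ∧ g x < x)
    (hright : ∃ h ∈ m.support, 0 < h 0) (x₀ : I) : ν {x₀} = 0 := by
  classical
  by_contra hx₀
  have hfin : ∀ ε : ℝ≥0∞, ε ≠ 0 → {x : I | ε ≤ ν {x}}.Finite := fun ε hε =>
    Measure.finite_const_le_meas_of_disjoint_iUnion ν (pos_iff_ne_zero.2 hε)
      (fun x => measurableSet_singleton x)
      (fun x y hxy => by simpa using hxy) (measure_ne_top _ _)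
  obtain ⟨x₁, hx₁, hmax⟩ := (hfin _ hx₀).exists_maximalFor (fun x => ν {x}) _ ⟨x₀, by simp⟩
  have hM : ∀ x, ν {x} ≤ ν {x₁} := by
    intro x
    rcases le_total (ν {x}) (ν {x₁}) with h | h
    · exact h
    · exact hmax (le_trans hx₁ h) h
  have hM0 : ν {x₁} ≠ 0 := fun h => hx₀ (le_antisymm (h ▸ hx₁) (zero_le))
  have hF := hfin _ hM0
  have hmem : ∀ x, x ∈ hF.toFinset ↔ ν {x} = ν {x₁} := by
    intro x
    simp only [Set.Finite.mem_toFinset, mem_ofPred_eq]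
    exact ⟨fun h => le_antisymm (hM x) h, fun h => h.ge⟩
  set F := hF.toFinset with hFdef
  have hx₁F : x₁ ∈ F := (hmem x₁).2 rfl
  have hae := hinv.ae_preimage_eq hinj hM0 hM hmem ⟨x₁, hx₁F⟩
  have hmaps : ∀ g ∈ m.support, ∀ x ∈ F, g x ∈ F := by
    intro g hg x hx
    by_contra hgx
    obtain ⟨w, hw, hw2⟩ := exists_mem_of_mem_support hg (U := {w : C(I, I) | w x ∈ (F : Set I)ᶜ})
      (F.finite_toSet.isClosed.isOpen_compl.preimage (continuous_eval_const x))
      (by simpa using hgx) hae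
    apply hw
    rw [← mem_preimage, hw2]; exact hx
  have hne : (F.filter fun x => 0 < x).Nonempty := by
    rcases eq_or_lt_of_le (unitInterval.nonneg' (t := x₁)) with h | h
    · obtain ⟨g, hg, hg0⟩ := hright
      exact ⟨g 0, Finset.mem_filter.2 ⟨hmaps g hg 0 (h ▸ hx₁F), hg0⟩⟩
    · exact ⟨x₁, Finset.mem_filter.2 ⟨hx₁F, h⟩⟩
  have hmin := Finset.min'_mem _ hne
  set z := (F.filter fun x => 0 < x).min' hne
  obtain ⟨hzF, hz0⟩ := Finset.mem_filter.1 hmin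
  obtain ⟨g, hg, hg0, hgz⟩ := hleft z hz0
  exact absurd (Finset.min'_le _ _ (Finset.mem_filter.2 ⟨hmaps g hg z hzF, hg0⟩)) (not_le.2 hgz)

end Atoms

/-! ### Variance of sets -/

/-- The variance of the indicator of `A` with respect to `ν`. -/
noncomputable def vr (ν : Measure I) (A : Set I) : ℝ := ν.real A * (1 - ν.real A)

/-- Equality modulo null sets and complementation. -/
def Sim (ν : Measure I) (A B : Set I) : Prop := A =ᵐ[ν] B ∨ A =ᵐ[ν] (Bᶜ : Set I)

/-- The mean variance of the preimage of `A` under a composition of `n` independent maps. -/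
noncomputable def meanVar [MeasurableSpace C(I, I)] (m : Measure C(I, I)) (ν : Measure I) (n : ℕ)
    (A : Set I) : ℝ := ∫ w, vr ν (w ⁻¹' A) ∂compLaw m n

/-- Sets whose preimages have almost surely the same measure, expressed through variances. -/
def Rigid [MeasurableSpace C(I, I)] (m : Measure C(I, I)) (ν : Measure I) (A : Set I) : Prop :=
  ∀ n, meanVar m ν n A = vr ν A

section Basic

variable {ν : Measure I} [IsProbabilityMeasure ν] {A B : Set I}

lemma vr_nonneg (A : Set I) : 0 ≤ vr ν A :=
  mul_nonneg measureReal_nonneg (sub_nonneg.2 measureReal_le_one)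

lemma vr_le_one (A : Set I) : vr ν A ≤ 1 :=
  mul_le_one₀ measureReal_le_one (sub_nonneg.2 measureReal_le_one)
    (sub_le_self _ measureReal_nonneg)

lemma norm_vr_le (A : Set I) : ‖vr ν A‖ ≤ 1 := by
  rw [Real.norm_of_nonneg (vr_nonneg A)]; exact vr_le_one A

lemma vr_compl (hA : MeasurableSet A) : vr ν Aᶜ = vr ν A := by
  rw [vr, vr, probReal_compl_eq_one_sub hA]; ring

lemma vr_eq_zero_iff (hA : MeasurableSet A) : vr ν A = 0 ↔ ν A = 0 ∨ ν Aᶜ = 0 := by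
  rw [vr, mul_eq_zero, measureReal_eq_zero_iff, ← probReal_compl_eq_one_sub hA,
    measureReal_eq_zero_iff]

lemma vr_congr (h : A =ᵐ[ν] B) : vr ν A = vr ν B := by
  rw [vr, vr, measureReal_congr h]

lemma Sim.vr_eq (hB : MeasurableSet B) (h : Sim ν A B) : vr ν A = vr ν B := by
  rcases h with h | h
  · exact vr_congr h
  · rw [vr_congr h, vr_compl hB]

lemma EqOff.sim (hν : ∀ x, ν {x} = 0) {F : Finset I} (h : EqOff F A B) : Sim ν A B := by
  have hnull : ν (F : Set I) = 0 := by
    rw [← sum_measure_singleton]; exact Finset.sum_eq_zero fun x _ => hν x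
  have hae : ∀ᵐ x ∂ν, x ∉ F := by
    rw [ae_iff]; simpa using hnull
  rcases h with h | h
  · left
    filter_upwards [hae] with x hx using propext (h x hx)
  · right
    filter_upwards [hae] with x hx using propext (h x hx)

lemma exists_sim_alt (hν : ∀ x, ν {x} = 0) (f : C(I, I)) {Y F : Finset I}
    (hF : f ⁻¹' (Y : Set I) ⊆ F) : ∃ Y' ⊆ F, Sim ν (f ⁻¹' alt Y id) (alt Y' id) := by
  obtain ⟨Y', hY', h⟩ := exists_preimage_alt f Y F fun x hx => hF hx
  exact ⟨Y', hY', h.sim hν⟩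

/-- The indicators converge at every point not mapped by `f` to a switch, and the exceptional points
form a null set. -/
lemma tendsto_measureReal_alt {ι : Type*} [Finite ι] {s : Finset ι} {y : ι → I} {f : C(I, I)}
    (h : ∀ i ∈ s, ν (f ⁻¹' {y i}) = 0) :
    Tendsto (fun z => ν.real (f ⁻¹' alt s z)) (𝓝 y) (𝓝 (ν.real (f ⁻¹' alt s y))) := by
  refine (ENNReal.tendsto_toReal (measure_ne_top _ _)).comp ?_
  refine tendsto_measure_of_ae_tendsto_indicator_of_isFiniteMeasure (𝓝 y)
    (f.continuous.measurable (measurableSet_alt s y))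
    (fun z => f.continuous.measurable (measurableSet_alt s z)) ?_
  have hae : ∀ᵐ x ∂ν, ∀ i ∈ s, f x ≠ y i := by
    rw [Filter.eventually_all_finset]
    intro i hi
    rw [ae_iff]
    simp only [ne_eq, not_not]
    exact h i hi
  filter_upwards [hae] with x hx
  have : ∀ᶠ z in 𝓝 y, ∀ i ∈ s, (z i < f x ↔ y i < f x) := by
    rw [Filter.eventually_all_finset]
    intro i hi
    have hc : Tendsto (fun z : ι → I => z i) (𝓝 y) (𝓝 (y i)) := (continuous_apply i).tendsto y
    rcases lt_or_gt_of_ne (hx i hi) with hlt | hlt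
    · filter_upwards [hc.eventually (lt_mem_nhds hlt)] with z hz
      exact iff_of_false (not_lt.2 hz.le) (not_lt.2 hlt.le)
    · filter_upwards [hc.eventually (gt_mem_nhds hlt)] with z hz
      exact iff_of_true hz hlt
  filter_upwards [this] with z hz
  simp only [mem_preimage, alt, mem_ofPred_eq]
  rw [Finset.filter_congr hz]

lemma continuous_vr_alt (hν : ∀ x, ν {x} = 0) {ι : Type*} [Finite ι] (s : Finset ι) :
    Continuous fun y : ι → I => vr ν (alt s y) := by
  have h : Continuous fun y : ι → I => ν.real (alt s y) :=
    continuous_iff_continuousAt.2 fun y =>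
      tendsto_measureReal_alt (f := ContinuousMap.id I) fun i _ => by simpa using hν (y i)
  exact h.mul (continuous_const.sub h)

/-- The tuple is padded with the value `1`, which lies to the left of no point and so creates no
switch. -/
lemma exists_tuple_alt_eq {Y : Finset I} {K : ℕ} (h : Y.card ≤ K) :
    ∃ y : Fin K → I, alt Finset.univ y = alt Y id := by
  classical
  obtain ⟨e⟩ : Nonempty (Y ↪ Fin K) := Function.Embedding.nonempty_of_card_le (by simpa using h)
  refine ⟨Function.extend e Subtype.val fun _ => 1, ?_⟩
  ext x
  simp only [alt, mem_ofPred_eq, id]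
  have : (Finset.univ.filter fun i => Function.extend e Subtype.val (fun _ => (1 : I)) i < x) =
      (Y.attach.filter fun p => p.1 < x).map e := by
    ext i
    simp only [Finset.mem_filter, Finset.mem_univ, true_and, Finset.mem_map, Finset.mem_attach]
    constructor
    · intro hi
      by_cases hex : ∃ p, e p = i
      · obtain ⟨p, rfl⟩ := hex
        rw [e.injective.extend_apply] at hi
        exact ⟨p, hi, rfl⟩
      · rw [Function.extend_apply' _ _ _ hex] at hi
        exact absurd hi (not_lt.2 unitInterval.le_one')
    · rintro ⟨p, hp, rfl⟩
      rwa [e.injective.extend_apply]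
  rw [this, Finset.card_map, ← Finset.card_map (Function.Embedding.subtype _)]
  congr! 2
  ext z
  simp only [Finset.mem_map, Finset.mem_filter, Finset.mem_attach, true_and]
  constructor
  · rintro ⟨p, hp, rfl⟩; exact ⟨p.2, hp⟩
  · rintro ⟨hz, hzx⟩; exact ⟨⟨z, hz⟩, hzx, rfl⟩

end Basic

/-! ### Decay of the mean variance, and rigidity -/

section MeanVariance

variable [MeasurableSpace C(I, I)] [BorelSpace C(I, I)] {m : Measure C(I, I)}
  [IsProbabilityMeasure m] {ν : Measure I} [IsProbabilityMeasure ν] {A B : Set I}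

lemma measurable_measureReal_preimage (hA : MeasurableSet A) :
    Measurable fun w : C(I, I) => ν.real (w ⁻¹' A) :=
  (measurable_measure_preimage ν hA).ennreal_toReal

lemma measurable_vr_preimage (hA : MeasurableSet A) :
    Measurable fun w : C(I, I) => vr ν (w ⁻¹' A) :=
  (measurable_measureReal_preimage hA).mul
    (measurable_const.sub (measurable_measureReal_preimage hA))

lemma integrable_measureReal_preimage (hA : MeasurableSet A) :
    Integrable (fun w : C(I, I) => ν.real (w ⁻¹' A)) m :=
  Integrable.of_bound (measurable_measureReal_preimage hA).aestronglyMeasurable 1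
    (ae_of_all _ fun _ => by
      rw [Real.norm_of_nonneg measureReal_nonneg]; exact measureReal_le_one)

lemma integrable_vr_preimage (hA : MeasurableSet A) :
    Integrable (fun w : C(I, I) => vr ν (w ⁻¹' A)) m :=
  Integrable.of_bound (measurable_vr_preimage hA).aestronglyMeasurable 1
    (ae_of_all _ fun _ => norm_vr_le _)

lemma LawInvariant.integral_measureReal (h : LawInvariant m ν) (hA : MeasurableSet A) :
    ∫ w : C(I, I), ν.real (w ⁻¹' A) ∂m = ν.real A := by
  rw [Measure.real, h A hA, ← integral_toReal (measurable_measure_preimage ν hA).aemeasurable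
    (ae_of_all _ fun w => measure_lt_top _ _)]
  rfl

/-- By invariance `ν(w⁻¹A)` has mean `ν(A)`; the loss of mean variance is therefore the variance of
this random variable. -/
lemma LawInvariant.vr_sub_integral (h : LawInvariant m ν) (hA : MeasurableSet A) :
    vr ν A - ∫ w : C(I, I), vr ν (w ⁻¹' A) ∂m =
      ∫ w : C(I, I), (ν.real (w ⁻¹' A) - ν.real A) ^ 2 ∂m := by
  have e : ∀ w : C(I, I), (ν.real (w ⁻¹' A) - ν.real A) ^ 2 =
      (1 - 2 * ν.real A) * ν.real (w ⁻¹' A) - vr ν (w ⁻¹' A) + ν.real A ^ 2 := by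
    intro w; rw [vr]; ring
  simp_rw [e]
  have i1 : Integrable (fun w : C(I, I) => (1 - 2 * ν.real A) * ν.real (w ⁻¹' A)) m :=
    (integrable_measureReal_preimage hA).const_mul _
  have i2 : Integrable (fun w : C(I, I) => vr ν (w ⁻¹' A)) m := integrable_vr_preimage hA
  have i3 : Integrable (fun w : C(I, I) =>
    (1 - 2 * ν.real A) * ν.real (w ⁻¹' A) - vr ν (w ⁻¹' A)) m := i1.sub i2
  rw [integral_add i3 (integrable_const _), integral_sub i1 i2,
    integral_const_mul, h.integral_measureReal hA, vr]
  simp; ring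

lemma LawInvariant.integral_vr_le (h : LawInvariant m ν) (hA : MeasurableSet A) :
    ∫ w : C(I, I), vr ν (w ⁻¹' A) ∂m ≤ vr ν A := by
  have := h.vr_sub_integral hA
  have h2 : 0 ≤ ∫ w : C(I, I), (ν.real (w ⁻¹' A) - ν.real A) ^ 2 ∂m :=
    integral_nonneg fun w => sq_nonneg _
  linarith

lemma LawInvariant.ae_measureReal_eq (h : LawInvariant m ν) (hA : MeasurableSet A)
    (he : ∫ w : C(I, I), vr ν (w ⁻¹' A) ∂m = vr ν A) :
    ∀ᵐ w : C(I, I) ∂m, ν.real (w ⁻¹' A) = ν.real A := by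
  have h1 := h.vr_sub_integral hA
  rw [he, sub_self, eq_comm, integral_eq_zero_iff_of_nonneg (fun w => sq_nonneg _)] at h1
  · filter_upwards [h1] with w hw
    simpa [sub_eq_zero] using hw
  · refine Integrable.of_bound (((measurable_measureReal_preimage hA).sub
      measurable_const).pow_const 2).aestronglyMeasurable 1 (ae_of_all _ fun w => ?_)
    rw [Real.norm_of_nonneg (sq_nonneg _), sq_le_one_iff_abs_le_one, abs_le]
    have := measureReal_nonneg (μ := ν) (s := w ⁻¹' A)
    have := measureReal_nonneg (μ := ν) (s := A)
    have := measureReal_le_one (μ := ν) (s := w ⁻¹' A)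
    have := measureReal_le_one (μ := ν) (s := A)
    constructor <;> linarith

lemma meanVar_nonneg (n : ℕ) : 0 ≤ meanVar m ν n A := integral_nonneg fun _ => vr_nonneg _

lemma meanVar_le_vr (h : LawInvariant m ν) (hA : MeasurableSet A) (n : ℕ) :
    meanVar m ν n A ≤ vr ν A := (h.compLaw n).integral_vr_le hA

lemma meanVar_le_one (n : ℕ) : meanVar m ν n A ≤ 1 := by
  refine (integral_mono_of_nonneg (ae_of_all _ fun _ => vr_nonneg _) (integrable_const 1)
    (ae_of_all _ fun _ => vr_le_one _)).trans ?_
  simp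

lemma meanVar_add (hA : MeasurableSet A) (a b : ℕ) :
    meanVar m ν (a + b) A = ∫ f : C(I, I), meanVar m ν b (f ⁻¹' A) ∂compLaw m a :=
  integral_compLaw_add m a b (measurable_vr_preimage hA) fun _ => norm_vr_le _

lemma measurable_meanVar_preimage (hA : MeasurableSet A) (n : ℕ) :
    Measurable fun f : C(I, I) => meanVar m ν n (f ⁻¹' A) := by
  have : StronglyMeasurable fun p : C(I, I) × C(I, I) => vr ν ((p.1.comp p.2) ⁻¹' A) :=
    ((measurable_vr_preimage hA).comp measurable_comp_prod).stronglyMeasurable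
  exact (this.integral_prod_right' (ν := compLaw m n)).measurable

lemma integrable_meanVar_preimage (hA : MeasurableSet A) (a n : ℕ) :
    Integrable (fun f : C(I, I) => meanVar m ν n (f ⁻¹' A)) (compLaw m a) :=
  Integrable.of_bound (measurable_meanVar_preimage hA n).aestronglyMeasurable 1
    (ae_of_all _ fun _ => by
      rw [Real.norm_of_nonneg (meanVar_nonneg n)]; exact meanVar_le_one n)

lemma meanVar_antitone (h : LawInvariant m ν) (hA : MeasurableSet A) :
    Antitone fun n => meanVar m ν n A := by
  intro a b hab
  obtain ⟨c, rfl⟩ := Nat.exists_eq_add_of_le hab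
  simp only [meanVar_add hA]
  exact integral_mono (integrable_meanVar_preimage hA a c) (integrable_vr_preimage hA)
    fun f => meanVar_le_vr h (f.continuous.measurable hA) c

lemma LawInvariant.ae_preimage_null (h : LawInvariant m ν) (hA : MeasurableSet A) (h0 : ν A = 0) :
    ∀ᵐ w : C(I, I) ∂m, ν (w ⁻¹' A) = 0 := by
  rw [h A hA, lintegral_eq_zero_iff (measurable_measure_preimage ν hA)] at h0
  exact h0

lemma LawInvariant.ae_preimage_congr (h : LawInvariant m ν) (hAB : A =ᵐ[ν] B) :
    ∀ᵐ w : C(I, I) ∂m, (w ⁻¹' A : Set I) =ᵐ[ν] (w ⁻¹' B : Set I) := by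
  obtain ⟨N, hN, hNm, hN0⟩ := exists_measurable_superset_of_null (ae_iff.1 hAB)
  filter_upwards [h.ae_preimage_null hNm hN0] with w hw
  refine measure_mono_null (fun x hx => ?_) hw
  exact hN hx

lemma Sim.meanVar_eq (hinv : LawInvariant m ν) (hB : MeasurableSet B) (h : Sim ν A B) (n : ℕ) :
    meanVar m ν n A = meanVar m ν n B := by
  rcases h with h | h
  · refine integral_congr_ae ?_
    filter_upwards [(hinv.compLaw n).ae_preimage_congr h] with w hw using vr_congr hw
  · refine integral_congr_ae ?_
    filter_upwards [(hinv.compLaw n).ae_preimage_congr h] with w hw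
    rw [vr_congr hw, preimage_compl, vr_compl (w.continuous.measurable hB)]

lemma Sim.rigid (hinv : LawInvariant m ν) (hB : MeasurableSet B) (h : Sim ν A B)
    (hA : Rigid m ν A) : Rigid m ν B := fun n => by
  rw [← h.meanVar_eq hinv hB, ← h.vr_eq hB, hA n]

/-- Pulling back `k` more steps can only lower the variance for each `w`. Rigidity makes the means
equal, so almost surely nothing is lost. -/
lemma Rigid.ae_preimage (hinv : LawInvariant m ν) (hAm : MeasurableSet A) (hA : Rigid m ν A)
    (n : ℕ) : ∀ᵐ w : C(I, I) ∂compLaw m n, vr ν (w ⁻¹' A) = vr ν A ∧ Rigid m ν (w ⁻¹' A) := by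
  have h1 : ∀ᵐ w : C(I, I) ∂compLaw m n, Rigid m ν (w ⁻¹' A) := by
    refine ae_all_iff.2 fun k => ?_
    have hle : (fun w : C(I, I) => meanVar m ν k (w ⁻¹' A)) ≤ fun w : C(I, I) => vr ν (w ⁻¹' A) :=
      fun w => meanVar_le_vr hinv (w.continuous.measurable hAm) k
    refine (integral_eq_iff_of_ae_le (integrable_meanVar_preimage hAm n k)
      (integrable_vr_preimage hAm) (ae_of_all _ hle)).1 ?_
    rw [← meanVar_add hAm, hA (n + k), ← hA n]; rfl
  filter_upwards [h1, (hinv.compLaw n).ae_measureReal_eq hAm (hA n)] with w hw1 hw2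
  exact ⟨by rw [vr, vr, hw2], hw1⟩

lemma continuous_meanVar_alt (hinv : LawInvariant m ν) (hν : ∀ x, ν {x} = 0) {ι : Type*} [Finite ι]
    (s : Finset ι) (n : ℕ) : Continuous fun y : ι → I => meanVar m ν n (alt s y) := by
  refine continuous_iff_continuousAt.2 fun y => ?_
  refine tendsto_integral_filter_of_dominated_convergence (fun _ => 1)
    (Eventually.of_forall fun z => (measurable_vr_preimage
      (measurableSet_alt s z)).aestronglyMeasurable)
    (Eventually.of_forall fun z => ae_of_all _ fun w => norm_vr_le _) (integrable_const 1) ?_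
  have hae : ∀ᵐ w : C(I, I) ∂compLaw m n, ∀ i ∈ s, ν (w ⁻¹' {y i}) = 0 := by
    rw [Filter.eventually_all_finset]
    exact fun i _ => (hinv.compLaw n).ae_preimage_null (measurableSet_singleton _) (hν _)
  filter_upwards [hae] with w hw
  exact (tendsto_measureReal_alt hw).mul (tendsto_const_nhds.sub (tendsto_measureReal_alt hw))

end MeanVariance

/-! ### Producing rigid sets by compactness -/

section Existence

variable [MeasurableSpace C(I, I)] [BorelSpace C(I, I)] {m : Measure C(I, I)}
  [IsProbabilityMeasure m] {ν : Measure I} [IsProbabilityMeasure ν]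

lemma exists_meanVar_sub_le (hinv : LawInvariant m ν) {A : Set I} (hA : MeasurableSet A) (j : ℕ)
    {ε : ℝ} (hε : 0 < ε) : ∃ n, meanVar m ν n A - meanVar m ν (n + j) A ≤ ε := by
  have hlim := tendsto_atTop_ciInf (meanVar_antitone (m := m) hinv hA)
    ⟨0, by rintro _ ⟨n, rfl⟩; exact meanVar_nonneg n⟩
  have h2 := hlim.sub (hlim.comp (tendsto_add_atTop_nat j))
  rw [sub_self] at h2
  obtain ⟨n, hn⟩ := (h2.eventually (gt_mem_nhds hε)).exists
  exact ⟨n, le_of_lt hn⟩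

lemma measurableSet_lt_encard (Z : Finset I) (K : ℕ) :
    MeasurableSet {w : C(I, I) | (K : ℕ∞) < (w ⁻¹' (Z : Set I)).encard} := by
  have : {w : C(I, I) | (K : ℕ∞) < (w ⁻¹' (Z : Set I)).encard} =
      (fun w : C(I, I) => ((w ⁻¹' (Z : Set I)).encard : ℝ≥0∞)) ⁻¹' Ioi ((K : ℕ∞) : ℝ≥0∞) := by
    ext w
    simp only [mem_ofPred_eq, mem_preimage, mem_Ioi, ENat.toENNReal_lt]
  rw [this]
  exact measurable_encard_preimage_finset Z measurableSet_Ioi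

/-- A word after which the variance hardly decreases any more. -/
lemma exists_word_almost_rigid (hinv : LawInvariant m ν) {Z : Finset I} {K : ℕ} {δ : ℝ} (hδ : 0 < δ)
    (hV : ∀ n, δ ≤ meanVar m ν n (alt Z id))
    (hK : ∀ n, (compLaw m n).real {w : C(I, I) | (K : ℕ∞) < (w ⁻¹' (Z : Set I)).encard} ≤ δ / 2)
    (j : ℕ) : ∃ w : C(I, I), (w ⁻¹' (Z : Set I)).encard ≤ K ∧ δ / 4 ≤ vr ν (w ⁻¹' alt Z id) ∧
      (j + 1) * (vr ν (w ⁻¹' alt Z id) - meanVar m ν j (w ⁻¹' alt Z id)) ≤ 1 := by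
  set A := alt Z id with hAdef
  have hA : MeasurableSet A := measurableSet_alt Z id
  have hj : (0 : ℝ) < j + 1 := by positivity
  obtain ⟨n, hn⟩ := exists_meanVar_sub_le hinv hA j (ε := δ / 4 / (j + 1)) (by positivity)
  set Bad := {w : C(I, I) | (K : ℕ∞) < (w ⁻¹' (Z : Set I)).encard} with hBad
  have hBm : MeasurableSet Bad := measurableSet_lt_encard Z K
  have i1 : Integrable (fun w : C(I, I) => vr ν (w ⁻¹' A)) (compLaw m n) :=
    integrable_vr_preimage hA
  have i2 : Integrable (fun w : C(I, I) => meanVar m ν j (w ⁻¹' A)) (compLaw m n) :=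
    integrable_meanVar_preimage hA n j
  have i3 : Integrable (fun w : C(I, I) =>
      ((j : ℝ) + 1) * (vr ν (w ⁻¹' A) - meanVar m ν j (w ⁻¹' A))) (compLaw m n) :=
    (i1.sub i2).const_mul _
  have i4 : Integrable (Bad.indicator (1 : C(I, I) → ℝ)) (compLaw m n) :=
    (integrable_const (1 : ℝ)).indicator hBm
  have i5 : Integrable (fun w : C(I, I) => vr ν (w ⁻¹' A) -
      ((j : ℝ) + 1) * (vr ν (w ⁻¹' A) - meanVar m ν j (w ⁻¹' A))) (compLaw m n) := i1.sub i3
  -- One functional selects all three properties at once: its mean is at least `δ - δ/4 - δ/2 =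
  -- δ/4`. On a bad word it would be at most `1 - 1 = 0`, so the selected word is good.
  obtain ⟨w, hw⟩ := exists_integral_le (i5.sub i4)
  simp only [Pi.sub_apply] at hw
  rw [integral_sub i5 i4, integral_sub i1 i3, integral_const_mul, integral_sub i1 i2,
    ← meanVar_add hA, integral_indicator_one hBm] at hw
  have e1 : ∫ w : C(I, I), vr ν (w ⁻¹' A) ∂compLaw m n = meanVar m ν n A := rfl
  rw [e1] at hw
  have e2 : ((j : ℝ) + 1) * (meanVar m ν n A - meanVar m ν (n + j) A) ≤ δ / 4 := by
    calc _ ≤ ((j : ℝ) + 1) * (δ / 4 / (j + 1)) := by gcongr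
      _ = δ / 4 := by field_simp
  have e3 := hV n
  have e4 := hK n
  have hdiff : 0 ≤ vr ν (w ⁻¹' A) - meanVar m ν j (w ⁻¹' A) :=
    sub_nonneg.2 (meanVar_le_vr hinv (w.continuous.measurable hA) j)
  have hprod := mul_nonneg hj.le hdiff
  have hle1 := vr_le_one (ν := ν) (w ⁻¹' A)
  have hX : δ / 4 ≤ vr ν (w ⁻¹' A) -
      (j + 1) * (vr ν (w ⁻¹' A) - meanVar m ν j (w ⁻¹' A)) - Bad.indicator 1 w := by
    linarith
  have hgood : w ∉ Bad := by
    intro hwB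
    rw [indicator_of_mem hwB, Pi.one_apply] at hX
    linarith
  rw [indicator_of_notMem hgood] at hX
  exact ⟨w, not_lt.1 hgood, by linarith, by linarith⟩

/-- If the mean variance of `alt Z id` does not tend to `0` and the number of preimages of `Z`
is mostly at most `K`, then there is a nontrivial rigid set with at most `K` switches. -/
lemma exists_rigid (hν : ∀ x, ν {x} = 0) (hinv : LawInvariant m ν) {Z : Finset I} {K : ℕ} {δ : ℝ}
    (hδ : 0 < δ) (hV : ∀ n, δ ≤ meanVar m ν n (alt Z id))
    (hK : ∀ n, (compLaw m n).real {w : C(I, I) | (K : ℕ∞) < (w ⁻¹' (Z : Set I)).encard} ≤ δ / 2) :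
    ∃ Y : Finset I, Y.card ≤ K ∧ Rigid m ν (alt Y id) ∧ 0 < vr ν (alt Y id) := by
  have key : ∀ j : ℕ, ∃ y : Fin K → I, δ / 4 ≤ vr ν (alt Finset.univ y) ∧
      vr ν (alt Finset.univ y) - meanVar m ν j (alt Finset.univ y) ≤ 1 / ((j : ℝ) + 1) := by
    intro j
    obtain ⟨w, hw1, hw2, hw3⟩ := exists_word_almost_rigid hinv hδ hV hK j
    have hfin : (w ⁻¹' (Z : Set I)).Finite :=
      Set.encard_lt_top_iff.1 (hw1.trans_lt (ENat.natCast_lt_top K))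
    obtain ⟨F, hF⟩ := hfin.exists_finset_coe
    rw [← hF, Set.encard_coe_eq_coe_finsetCard, Nat.cast_le] at hw1
    obtain ⟨Y, hYF, hs⟩ := exists_sim_alt hν w hF.ge
    obtain ⟨y, hy⟩ := exists_tuple_alt_eq ((Finset.card_le_card hYF).trans hw1)
    refine ⟨y, ?_⟩
    rw [hy, ← hs.vr_eq (measurableSet_alt _ _), ← hs.meanVar_eq hinv (measurableSet_alt _ _)]
    refine ⟨hw2, ?_⟩
    rw [le_div_iff₀ (by positivity), mul_comm]
    exact hw3
  choose y hy1 hy2 using key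
  obtain ⟨z, φ, hφ, hz⟩ := CompactSpace.tendsto_subseq y
  have hvr : Tendsto (fun n => vr ν (alt Finset.univ (y (φ n)))) atTop
      (𝓝 (vr ν (alt Finset.univ z))) :=
    ((continuous_vr_alt hν Finset.univ).tendsto z).comp hz
  have hpos : δ / 4 ≤ vr ν (alt Finset.univ z) := ge_of_tendsto' hvr fun n => hy1 _
  have hrig : Rigid m ν (alt Finset.univ z) := by
    intro i
    refine le_antisymm (meanVar_le_vr hinv (measurableSet_alt _ _) i) ?_
    have hmv : Tendsto (fun n => meanVar m ν i (alt Finset.univ (y (φ n)))) atTop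
        (𝓝 (meanVar m ν i (alt Finset.univ z))) :=
      ((continuous_meanVar_alt hinv hν Finset.univ i).tendsto z).comp hz
    have h0 : Tendsto (fun n => 1 / ((φ n : ℝ) + 1)) atTop (𝓝 0) :=
      tendsto_one_div_add_atTop_nhds_zero_nat.comp hφ.tendsto_atTop
    have hsum := hmv.add h0
    rw [add_zero] at hsum
    refine le_of_tendsto_of_tendsto hvr hsum ?_
    filter_upwards [eventually_ge_atTop i] with n hn
    -- The loss over `φ n ≥ i` steps is at most `1 / (φ n + 1)` and dominates the loss over `i`
    -- steps.
    have h1 := hy2 (φ n)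
    have h2 := meanVar_antitone (m := m) hinv (measurableSet_alt Finset.univ (y (φ n)))
      (hn.trans (hφ.id_le n))
    simp only at h2
    linarith
  obtain ⟨Y, -, hYc, hY⟩ := exists_finset_alt_eq Finset.univ z
  refine ⟨Y, by simpa using hYc, ?_, ?_⟩
  · rw [hY]; exact hrig
  · rw [hY]; linarith

end Existence

/-! ### Rigid sets with the least number of switches -/

lemma alt_union {ι : Type*} [DecidableEq ι] {s t : Finset ι} (h : Disjoint s t) (y : ι → I) :
    alt (s ∪ t) y = symmDiff (alt s y) (alt t y) := by
  ext x
  rw [mem_alt_union h, Set.mem_symmDiff]; tauto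

lemma Sim.symmDiff_symmDiff {ν : Measure I} {A A' B B' : Set I} (h : Sim ν A A') (h' : Sim ν B B') :
    Sim ν (symmDiff A B) (symmDiff A' B') := by
  have e : ∀ {A A' B B' : Set I}, A =ᵐ[ν] A' → B =ᵐ[ν] B' →
      (symmDiff A B : Set I) =ᵐ[ν] (symmDiff A' B' : Set I) := fun h h' =>
    (h.diff h').union (h'.diff h)
  rcases h with h | h <;> rcases h' with h' | h'
  · exact Or.inl (e h h')
  · have : (symmDiff A' B')ᶜ = symmDiff A' B'ᶜ := by
      ext x; simp only [Set.mem_symmDiff, mem_compl_iff]; tauto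
    exact Or.inr (this ▸ e h h')
  · have : (symmDiff A' B')ᶜ = symmDiff A'ᶜ B' := by
      ext x; simp only [Set.mem_symmDiff, mem_compl_iff]; tauto
    exact Or.inr (this ▸ e h h')
  · have : symmDiff A' B' = symmDiff A'ᶜ B'ᶜ := by
      ext x; simp only [Set.mem_symmDiff, mem_compl_iff]; tauto
    exact Or.inl (this ▸ e h h')

section Minimal

variable [MeasurableSpace C(I, I)] [BorelSpace C(I, I)] {m : Measure C(I, I)}
  [IsProbabilityMeasure m] {ν : Measure I} [IsProbabilityMeasure ν]

/-- Every nontrivial rigid set has at least `k` switches. -/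
def SwitchBound (m : Measure C(I, I)) (ν : Measure I) (k : ℕ) : Prop :=
  ∀ Y : Finset I, Rigid m ν (alt Y id) → 0 < vr ν (alt Y id) → k ≤ Y.card

/-- The switching points of a rigid set with exactly `k` switches and variance `c`. -/
def RigidSwitches (m : Measure C(I, I)) (ν : Measure I) (k : ℕ) (c : ℝ) (Y : Finset I) : Prop :=
  Y.card = k ∧ Rigid m ν (alt Y id) ∧ vr ν (alt Y id) = c

variable {k : ℕ} {c : ℝ}

lemma SwitchBound.le_card_of_sim (hk : SwitchBound m ν k) (hinv : LawInvariant m ν) {B : Set I}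
    (hB : Rigid m ν B) (hB0 : 0 < vr ν B) {Y : Finset I} (hs : Sim ν B (alt Y id)) :
    k ≤ Y.card :=
  hk Y (hs.rigid hinv (measurableSet_alt _ _) hB) (hs.vr_eq (measurableSet_alt _ _) ▸ hB0)

/-- The preimage is again rigid with the same variance, so it needs at least `k` switches, all among
the preimages of `Y`. Since there are at most `k` of these on average, there are exactly `k`, and
each one is a switch. -/
lemma RigidSwitches.ae_preimage (hk : SwitchBound m ν k) (hν : ∀ x, ν {x} = 0)
    (hinv : LawInvariant m ν) (hinj : LawInjective m) (hc : 0 < c) {Y : Finset I}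
    (hY : RigidSwitches m ν k c Y) (n : ℕ) :
    ∀ᵐ w : C(I, I) ∂compLaw m n, ∃ F : Finset I, (F : Set I) = w ⁻¹' Y ∧
      RigidSwitches m ν k c F ∧ Rigid m ν (w ⁻¹' alt Y id) ∧ 0 < vr ν (w ⁻¹' alt Y id) ∧
      EqOff F (w ⁻¹' alt Y id) (alt F id) := by
  obtain ⟨hcard, hrig, hvr⟩ := hY
  have hr := hrig.ae_preimage hinv (measurableSet_alt _ _) n
  have hle : ∀ᵐ w : C(I, I) ∂compLaw m n, ((k : ℕ∞) : ℝ≥0∞) ≤ (w ⁻¹' (Y : Set I)).encard := by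
    filter_upwards [hr] with w hw
    rw [ENat.toENNReal_le]
    by_cases hfin : (w ⁻¹' (Y : Set I)).Finite
    · obtain ⟨F, hF⟩ := hfin.exists_finset_coe
      obtain ⟨Y', hY', hs⟩ := exists_sim_alt hν w hF.ge
      rw [← hF, Set.encard_coe_eq_coe_finsetCard, Nat.cast_le]
      exact (hk.le_card_of_sim hinv hw.2 (by rw [hw.1, hvr]; exact hc) hs).trans
        (Finset.card_le_card hY')
    · rw [Set.not_finite.1 hfin |>.encard_eq]; exact le_top
  have heq := ae_eq_of_ae_le_of_lintegral_le hle (by simp)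
    (measurable_encard_preimage_finset Y).aemeasurable (by
      refine ((hinj.compLaw n).lintegral_encard_le (Y : Set I)).trans ?_
      simp [Set.encard_coe_eq_coe_finsetCard, hcard])
  filter_upwards [hr, heq] with w hw hw2
  rw [ENat.toENNReal_inj] at hw2
  obtain ⟨F, hF⟩ := (Set.finite_of_encard_eq_coe hw2.symm).exists_finset_coe
  rw [← hF, Set.encard_coe_eq_coe_finsetCard, Nat.cast_inj] at hw2
  obtain ⟨Y', hY', heq⟩ := exists_preimage_alt w Y F fun x hx => hF.ge hx
  have hs := heq.sim hν
  have hpos : 0 < vr ν (w ⁻¹' alt Y id) := by rw [hw.1, hvr]; exact hc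
  have hkY' := hk.le_card_of_sim hinv hw.2 hpos hs
  obtain rfl : Y' = F := Finset.eq_of_subset_of_card_le hY' (hw2 ▸ hkY')
  exact ⟨Y', hF, ⟨hw2.symm, hs.rigid hinv (measurableSet_alt _ _) hw.2,
    by rw [← hs.vr_eq (measurableSet_alt _ _), hw.1, hvr]⟩, hw.2, hpos, heq⟩

/-- Split `alt Y` as the symmetric difference of `alt Z` and `alt (Y \ Z)`. If the preimage of `alt
Z` skipped a point over `Z`, the preimage of `alt Y` would be described by fewer than `k` switches.
-/
lemma sim_preimage_alt_of_subset (hk : SwitchBound m ν k) (hν : ∀ x, ν {x} = 0)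
    (hinv : LawInvariant m ν) {Y Z F : Finset I} {w : C(I, I)} (hF : (F : Set I) = w ⁻¹' Y)
    (hcard : F.card = k) (hr : Rigid m ν (w ⁻¹' alt Y id)) (hpos : 0 < vr ν (w ⁻¹' alt Y id))
    (hZ : Z ⊆ Y) : Sim ν (w ⁻¹' alt Z id) (alt (F.filter fun x => w x ∈ Z) id) := by
  have hmem : ∀ x, x ∈ F ↔ w x ∈ Y := fun x => by
    rw [← Finset.mem_coe, hF]; simp
  obtain ⟨Y1, hY1, hs1⟩ := exists_sim_alt hν w (Y := Z) (F := F.filter fun x => w x ∈ Z)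
    (fun x hx => by
      have hx' : w x ∈ Z := hx
      simp [hmem, hx', hZ hx'])
  obtain ⟨Y2, hY2, hs2⟩ := exists_sim_alt hν w (Y := Y \ Z) (F := F.filter fun x => w x ∉ Z)
    (fun x hx => by
      have hx' : w x ∈ Y \ Z := hx
      rw [Finset.mem_sdiff] at hx'
      simp [hmem, hx'])
  have hs := hs1.symmDiff_symmDiff hs2
  rw [← preimage_symmDiff, ← alt_union Finset.disjoint_sdiff, Finset.union_sdiff_of_subset hZ,
    ← alt_union ((Finset.disjoint_filter_filter_not _ _ _).mono hY1 hY2)] at hs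
  have h1 := hk.le_card_of_sim hinv hr hpos hs
  have h2 := Finset.card_union_le Y1 Y2
  have h3 := Finset.card_le_card hY2
  have h4 := Finset.card_filter_add_card_filter_not (s := F) fun x => w x ∈ Z
  rwa [Finset.eq_of_subset_of_card_le hY1 (by omega)] at hs1

/-- If `alt Z` were trivial, `alt Y` would agree with `alt (Y \ Z)` up to complement, with too few
switches. -/
lemma RigidSwitches.vr_pos_of_subset (hk : SwitchBound m ν k) (hinv : LawInvariant m ν) (hc : 0 < c)
    {Y Z : Finset I} (hY : RigidSwitches m ν k c Y) (hZ : Z ⊂ Y) (hne : Z.Nonempty) :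
    0 < vr ν (alt Z id) := by
  refine (vr_nonneg _).lt_of_ne fun h0 => ?_
  have hs : Sim ν (alt Z id) ∅ := by
    rcases (vr_eq_zero_iff (measurableSet_alt _ _)).1 h0.symm with h | h
    · exact Or.inl (ae_eq_empty.2 h)
    · right; rw [compl_empty]; exact ae_eq_univ.2 h
  have hs2 := hs.symmDiff_symmDiff (Or.inl (EventuallyEq.rfl) : Sim ν (alt (Y \ Z) id) (alt (Y \ Z) id))
  rw [← alt_union Finset.disjoint_sdiff, Finset.union_sdiff_of_subset hZ.1,
    ← Set.bot_eq_empty, bot_symmDiff] at hs2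
  have h1 := hk.le_card_of_sim hinv hY.2.1 (hY.2.2 ▸ hc) hs2
  have h2 := Finset.card_sdiff_of_subset hZ.1
  have h3 := hne.card_pos
  have h4 := Finset.card_le_card hZ.1
  have h5 := hY.1
  omega

/-- The increasing enumerations of rigid switching sets. -/
def rigidTuples (m : Measure C(I, I)) (ν : Measure I) (k : ℕ) (c : ℝ) : Set (Fin k → I) :=
  {y | Monotone y ∧ Rigid m ν (alt Finset.univ y) ∧ vr ν (alt Finset.univ y) = c}

/-- Weak monotonicity keeps the set closed; collisions of switches are excluded later by the
minimality of `k`. -/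
lemma isCompact_rigidTuples (hν : ∀ x, ν {x} = 0) (hinv : LawInvariant m ν) :
    IsCompact (rigidTuples m ν k c) := by
  refine IsClosed.isCompact ?_
  have h1 : IsClosed {y : Fin k → I | Monotone y} := by
    simp only [Monotone, Set.ofPred_forall]
    exact isClosed_iInter fun i => isClosed_iInter fun j => isClosed_iInter fun _ =>
      isClosed_le (continuous_apply i) (continuous_apply j)
  have h2 : IsClosed {y : Fin k → I | Rigid m ν (alt Finset.univ y)} := by
    simp only [Rigid, Set.ofPred_forall]
    exact isClosed_iInter fun n =>
      isClosed_eq (continuous_meanVar_alt hinv hν _ n) (continuous_vr_alt hν _)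
  have h3 : IsClosed {y : Fin k → I | vr ν (alt Finset.univ y) = c} :=
    isClosed_eq (continuous_vr_alt hν _) continuous_const
  exact h1.inter (h2.inter h3)

lemma RigidSwitches.exists_tuple {Y : Finset I} (hY : RigidSwitches m ν k c Y) :
    ∃ y ∈ rigidTuples m ν k c, StrictMono y ∧ Finset.univ.image y = Y := by
  have himg : Finset.univ.image (Y.orderEmbOfFin hY.1) = Y := by
    apply Finset.coe_injective
    simp
  refine ⟨Y.orderEmbOfFin hY.1, ?_, OrderEmbedding.strictMono _, himg⟩
  have : alt Finset.univ (Y.orderEmbOfFin hY.1) = alt Y id := by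
    rw [← alt_image (RelEmbedding.injective _).injOn, himg]
  refine ⟨OrderEmbedding.monotone _, ?_, ?_⟩
  · rw [this]; exact hY.2.1
  · rw [this]; exact hY.2.2

/-- Two equal entries would cancel and leave a nontrivial rigid set with fewer than `k` switches. -/
lemma rigidSwitches_of_mem_rigidTuples (hk : SwitchBound m ν k) (hc : 0 < c) {y : Fin k → I}
    (hy : y ∈ rigidTuples m ν k c) :
    StrictMono y ∧ RigidSwitches m ν k c (Finset.univ.image y) := by
  obtain ⟨hmono, hr, hv⟩ := hy
  obtain ⟨Y, hYs, hYc, hYe⟩ := exists_finset_alt_eq Finset.univ y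
  have h1 := hk Y (hYe ▸ hr) (by rw [hYe, hv]; exact hc)
  have h2 : (Finset.univ.image y).card ≤ k := by
    simpa using Finset.card_image_le (s := (Finset.univ : Finset (Fin k))) (f := y)
  have h3 : Y = Finset.univ.image y := Finset.eq_of_subset_of_card_le hYs (h2.trans h1)
  have h4 : (Finset.univ.image y).card = k := le_antisymm h2 (h3 ▸ h1)
  have hinj : Function.Injective y := by
    have := Finset.card_image_iff.1 (h4.trans (by simp : k = (Finset.univ : Finset (Fin k)).card))
    simpa [Set.injOn_univ] using this
  exact ⟨hmono.strictMono_of_injective hinj, h4, h3 ▸ hYe ▸ hr, by rw [← h3, hYe, hv]⟩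

/-- For each of the finitely many index patterns `T`, the variance is continuous and positive on the
compact set of rigid tuples, hence bounded below. -/
lemma exists_vr_lower_bound (hk : SwitchBound m ν k) (hν : ∀ x, ν {x} = 0)
    (hinv : LawInvariant m ν) (hc : 0 < c) :
    ∃ ε > 0, ∀ Y Z : Finset I, RigidSwitches m ν k c Y → Z ⊂ Y → Z.Nonempty →
      ε ≤ vr ν (alt Z id) := by
  have key : ∀ T : Finset (Fin k), ∃ ε > 0, T.Nonempty → T ≠ Finset.univ →
      ∀ y ∈ rigidTuples m ν k c, ε ≤ vr ν (alt T y) := by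
    intro T
    by_cases hT : T.Nonempty ∧ T ≠ Finset.univ ∧ (rigidTuples m ν k c).Nonempty
    · obtain ⟨hT1, hT2, hne⟩ := hT
      obtain ⟨y, hy, hmin⟩ := (isCompact_rigidTuples (m := m) (c := c) hν hinv).exists_isMinOn hne
        (continuous_vr_alt hν T).continuousOn
      refine ⟨vr ν (alt T y), ?_, fun _ _ z hz => hmin hz⟩
      obtain ⟨hsm, hrs⟩ := rigidSwitches_of_mem_rigidTuples hk hc hy
      rw [← alt_image hsm.injective.injOn]
      refine hrs.vr_pos_of_subset hk hinv hc ?_ (hT1.image y)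
      rw [Finset.image_ssubset_image hsm.injective]
      exact Finset.ssubset_univ_iff.2 hT2
    · refine ⟨1, one_pos, fun h1 h2 y hy => absurd ⟨h1, h2, ⟨y, hy⟩⟩ hT⟩
  choose ε hε hεT using key
  refine ⟨Finset.univ.inf' Finset.univ_nonempty ε, (Finset.lt_inf'_iff _).2 fun T _ => hε T, ?_⟩
  intro Y Z hY hZ hne
  obtain ⟨y, hy, hsm, himg⟩ := hY.exists_tuple
  have hZi : (Finset.univ.filter fun i => y i ∈ Z).image y = Z := by
    ext z
    simp only [Finset.mem_image, Finset.mem_filter, Finset.mem_univ, true_and]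
    constructor
    · rintro ⟨i, hi, rfl⟩; exact hi
    · intro hz
      have := hZ.1 hz
      rw [← himg, Finset.mem_image] at this
      obtain ⟨i, -, rfl⟩ := this
      exact ⟨i, hz, rfl⟩
  rw [← hZi, alt_image hsm.injective.injOn]
  refine (Finset.inf'_le _ (Finset.mem_univ _)).trans (hεT _ ?_ ?_ y hy)
  · rw [← Finset.image_nonempty (f := y), hZi]; exact hne
  · intro h
    rw [h, himg] at hZi
    exact hZ.ne hZi.symm

end Minimal

/-! ### Ruling out nontrivial rigid sets -/

section Contradiction

variable [MeasurableSpace C(I, I)] [BorelSpace C(I, I)] {m : Measure C(I, I)}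
  [IsProbabilityMeasure m] {ν : Measure I} [IsProbabilityMeasure ν] {k : ℕ} {c : ℝ}

/-- A proper nonempty part of a minimal rigid switching set is killed with positive probability. -/
lemma RigidSwitches.exists_not_ae_nonempty (hk : SwitchBound m ν k) (hν : ∀ x, ν {x} = 0)
    (hinv : LawInvariant m ν) (hinj : LawInjective m) (hc : 0 < c) {Y Z : Finset I}
    (hY : RigidSwitches m ν k c Y) (hZ : Z ⊂ Y) :
    ∃ n, ¬∀ᵐ w : C(I, I) ∂compLaw m n, (w ⁻¹' (Z : Set I)).Nonempty := by
  classical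
  by_contra! H
  obtain ⟨ε, hε, hεle⟩ := exists_vr_lower_bound hk hν hinv hc
  -- `p` is the least number of preimages of `Z` occurring with positive probability at any length.
  -- The identity word gives `p ≤ #Z < k`, and the assumption `H` gives `p > 0`.
  have hex : ∃ p : ℕ, ∃ n, ¬∀ᵐ w : C(I, I) ∂compLaw m n, (w ⁻¹' (Z : Set I)).encard ≠ p := by
    refine ⟨Z.card, 0, ?_⟩
    simp only [compLaw]
    rw [ae_dirac_eq]
    simp [Set.encard_coe_eq_coe_finsetCard]
  set p := Nat.find hex with hp
  obtain ⟨n₀, hn₀⟩ := Nat.find_spec hex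
  rw [← hp] at hn₀
  have hpZ : p ≤ Z.card := by
    refine Nat.find_min' hex ⟨0, ?_⟩
    simp only [compLaw]
    rw [ae_dirac_eq]
    simp [Set.encard_coe_eq_coe_finsetCard]
  have hpk : p < k := hpZ.trans_lt (hY.1 ▸ Finset.card_lt_card hZ)
  have hp0 : 0 < p := by
    rw [Nat.pos_iff_ne_zero]
    intro h0
    rw [h0] at hn₀
    refine hn₀ ((H n₀).mono fun w hw => ?_)
    simpa using hw.ne_empty
  have hge : ∀ n, ∀ᵐ w : C(I, I) ∂compLaw m n, (p : ℕ∞) ≤ (w ⁻¹' (Z : Set I)).encard := by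
    intro n
    have h : ∀ᵐ w : C(I, I) ∂compLaw m n, ∀ q : ℕ, q < p → (w ⁻¹' (Z : Set I)).encard ≠ q := by
      refine ae_all_iff.2 fun q => ?_
      by_cases hq : q < p
      · have := Nat.find_min hex hq
        push Not at this
        exact (this n).mono fun w hw _ => hw
      · exact ae_of_all _ fun w h => absurd h hq
    filter_upwards [h] with w hw
    by_contra! hlt
    obtain ⟨q, hq⟩ := ENat.ne_top_iff_exists.1 (hlt.trans_le le_top).ne
    rw [← hq, Nat.cast_lt] at hlt
    exact hw q hlt hq.symm
  have h1 : ∀ᵐ f : C(I, I) ∂compLaw m n₀, ∀ n, ∀ᵐ g : C(I, I) ∂compLaw m n,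
      (p : ℕ∞) ≤ ((f.comp g) ⁻¹' (Z : Set I)).encard :=
    ae_all_iff.2 fun n => ae_ae_of_ae_compLaw_add m (hge (n₀ + n))
  obtain ⟨f, hfp, hf1, F, hF, hFr, -⟩ := ((Filter.not_eventually.1 hn₀).and_eventually
    (h1.and (hY.ae_preimage hk hν hinv hinj hc n₀))).exists
  rw [not_not] at hfp
  have hFmem : ∀ x, x ∈ F ↔ f x ∈ Y := fun x => by
    rw [← Finset.mem_coe, hF]; simp
  set Z' := F.filter fun x => f x ∈ Z with hZ'
  have hZ'eq : (Z' : Set I) = f ⁻¹' Z := by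
    ext x
    simp only [hZ', Finset.coe_filter, mem_ofPred_eq, hFmem, mem_preimage, Finset.mem_coe]
    exact ⟨fun h => h.2, fun h => ⟨hZ.1 h, h⟩⟩
  have hZ'card : Z'.card = p := by
    rw [← hZ'eq, Set.encard_coe_eq_coe_finsetCard, Nat.cast_inj] at hfp
    exact hfp
  -- Minimality of `p`, applied to `f ∘ g`, gives at least `p` preimages of `Z'`; injectivity gives
  -- at most `p` on average.
  have heq : ∀ n, ∀ᵐ g : C(I, I) ∂compLaw m n, (g ⁻¹' (Z' : Set I)).encard = p := by
    intro n
    have hle : ∀ᵐ g : C(I, I) ∂compLaw m n, ((p : ℕ∞) : ℝ≥0∞) ≤ (g ⁻¹' (Z' : Set I)).encard := by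
      filter_upwards [hf1 n] with g hg
      rw [ENat.toENNReal_le, hZ'eq]
      exact hg
    have := ae_eq_of_ae_le_of_lintegral_le hle (by simp)
      (measurable_encard_preimage_finset Z').aemeasurable (by
        refine ((hinj.compLaw n).lintegral_encard_le (Z' : Set I)).trans ?_
        simp [Set.encard_coe_eq_coe_finsetCard, hZ'card])
    filter_upwards [this] with g hg
    rw [ENat.toENNReal_inj] at hg
    exact hg.symm
  -- The preimage of `alt Z'` switches at `p` points of a rigid switching set, where `0 < p < k`, so
  -- the uniform bound on proper nonempty parts applies.
  have hV : ∀ n, ε ≤ meanVar m ν n (alt Z' id) := by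
    intro n
    have : ∀ᵐ g : C(I, I) ∂compLaw m n, ε ≤ vr ν (g ⁻¹' alt Z' id) := by
      filter_upwards [heq n, hFr.ae_preimage hk hν hinv hinj hc n] with g hg hg2
      obtain ⟨G, hG, hGr, hr, hpos, -⟩ := hg2
      have hs := sim_preimage_alt_of_subset hk hν hinv hG hGr.1 hr hpos (Finset.filter_subset _ F :
        Z' ⊆ F)
      rw [hs.vr_eq (measurableSet_alt _ _)]
      have hGmem : ∀ x, x ∈ G ↔ g x ∈ F := fun x => by
        rw [← Finset.mem_coe, hG]; simp
      have hcoe : ((G.filter fun x => g x ∈ Z' : Finset I) : Set I) = g ⁻¹' Z' := by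
        ext x
        simp only [Finset.coe_filter, mem_ofPred_eq, hGmem, mem_preimage, Finset.mem_coe]
        exact ⟨fun h => h.2, fun h => ⟨Finset.filter_subset _ F h, h⟩⟩
      have hcardG : (G.filter fun x => g x ∈ Z').card = p := by
        rw [← hcoe, Set.encard_coe_eq_coe_finsetCard, Nat.cast_inj] at hg
        exact hg
      refine hεle G _ hGr ((Finset.filter_subset _ _).ssubset_of_ne fun h => ?_) ?_
      · rw [h, hGr.1] at hcardG; omega
      · rw [← Finset.card_pos, hcardG]; exact hp0
    calc ε = ∫ _, ε ∂compLaw m n := by simp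
      _ ≤ meanVar m ν n (alt Z' id) :=
        integral_mono_ae (integrable_const _) (integrable_vr_preimage (measurableSet_alt _ _)) this
  -- Words with more than `p` preimages have probability zero, so the rigid set obtained has at most
  -- `p < k` switches.
  obtain ⟨W, hWc, hWr, hWv⟩ := exists_rigid hν hinv (K := p) hε hV (fun n => by
    rw [measureReal_eq_zero_iff (measure_ne_top _ _) |>.2]
    · positivity
    · refine measure_mono_null (fun g hg => ?_) (heq n)
      simp only [mem_ofPred_eq] at hg
      exact fun h => hg.ne' h)
  have := hk W hWr hWv
  omega

/-- If a continuous map is below `a` at `0` and at `a`, and reaches `a` at most at one point `p`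
of `[0, a]`, then it is below `a` elsewhere on `[0, a]`. -/
lemma lt_of_touching {w : C(I, I)} {a p : I} (hw0 : w 0 < a) (hwa : w a < a)
    (hp : ∀ x < a, x ≠ p → w x ≠ a) : ∀ x < a, x ≠ p → w x < a := by
  have hav : ∀ z, z ≤ a → z ≠ p → w z ≠ a := by
    intro z hz hzp hza
    rcases hz.lt_or_eq with h | rfl
    · exact hp z h hzp hza
    · exact hwa.ne hza
  intro x hxa hxp
  by_contra! hge
  rcases lt_or_gt_of_ne hxp with h | h
  · obtain ⟨z, hz, hza⟩ := intermediate_value_Icc (unitInterval.nonneg' (t := x))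
      w.continuous.continuousOn ⟨hw0.le, hge⟩
    exact hav z (hz.2.trans hxa.le) (hz.2.trans_lt h).ne hza
  · obtain ⟨z, hz, hza⟩ := intermediate_value_Icc' hxa.le w.continuous.continuousOn ⟨hwa.le, hge⟩
    exact hav z hz.2 (h.trans_le hz.1).ne' hza

lemma compLaw_one : compLaw m 1 = m := by
  refine Measure.ext_of_lintegral _ fun φ hφ => ?_
  simp only [compLaw]
  rw [lintegral_map_comp _ _ hφ, lintegral_dirac' _ (measurable_lintegral_comp m hφ)]
  simp

/-- A switch at `0` separates only the null set `{0}`, so it is superfluous. -/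
lemma RigidSwitches.pos_of_mem (hk : SwitchBound m ν k) (hν : ∀ x, ν {x} = 0)
    (hinv : LawInvariant m ν) (hc : 0 < c) {Y : Finset I} (hY : RigidSwitches m ν k c Y) {y : I}
    (hy : y ∈ Y) : 0 < y := by
  refine lt_of_le_of_ne unitInterval.nonneg' fun h0 => ?_
  subst h0
  have h0 : vr ν (alt {(0 : I)} id) = 0 := by
    rw [vr_eq_zero_iff (measurableSet_alt _ _)]
    refine Or.inr (measure_mono_null (fun x hx => ?_) (hν 0))
    rw [mem_compl_iff, mem_alt_singleton, id, not_lt] at hx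
    exact le_antisymm hx unitInterval.nonneg'
  rcases (Finset.singleton_subset_iff.2 hy).eq_or_ssubset with h | h
  · rw [h, hY.2.2] at h0
    exact hc.ne' h0
  · exact (hY.vr_pos_of_subset hk hinv hc h (Finset.singleton_nonempty _)).ne' h0

/-- Choose a word whose image avoids every `z l` except `z i`, while both full preimages remain
nonempty. It then takes the value `z i < z j` and some value `y r ≥ y i`; if `z j ≤ y i`, the
intermediate value theorem makes it hit the forbidden `z j`. -/
lemma lt_of_mem_rigidTuples (hk : SwitchBound m ν k) (hν : ∀ x, ν {x} = 0)
    (hinv : LawInvariant m ν) (hinj : LawInjective m) (hc : 0 < c) {y z : Fin k → I}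
    (hy : y ∈ rigidTuples m ν k c) (hz : z ∈ rigidTuples m ν k c) {i j : Fin k} (hij : i < j)
    (hi : ∀ l, i ≤ l) : y i < z j := by
  by_contra! hle
  obtain ⟨hym, hyr⟩ := rigidSwitches_of_mem_rigidTuples hk hc hy
  obtain ⟨hzm, hzr⟩ := rigidSwitches_of_mem_rigidTuples hk hc hz
  have hZ : (Finset.univ.image z).erase (z i) ⊂ Finset.univ.image z :=
    Finset.erase_ssubset (Finset.mem_image_of_mem _ (Finset.mem_univ _))
  obtain ⟨n, hn⟩ := hzr.exists_not_ae_nonempty hk hν hinv hinj hc hZ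
  obtain ⟨w, hw, ⟨F, hF, hFr, -⟩, G, hG, hGr, -⟩ := ((Filter.not_eventually.1 hn).and_eventually
    ((hzr.ae_preimage hk hν hinv hinj hc n).and (hyr.ae_preimage hk hν hinv hinj hc n))).exists
  have hkpos : 0 < k := i.pos
  have hav : ∀ l, l ≠ i → ∀ x, w x ≠ z l := by
    intro l hl x hx
    refine hw ⟨x, ?_⟩
    rw [mem_preimage, Finset.mem_coe, hx, Finset.mem_erase]
    exact ⟨fun h => hl (hzm.injective h), Finset.mem_image_of_mem _ (Finset.mem_univ _)⟩
  obtain ⟨p, hp⟩ : F.Nonempty := by rw [← Finset.card_pos, hFr.1]; exact hkpos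
  have hwp : w p ∈ (Finset.univ.image z : Finset I) := by
    rw [← Finset.mem_coe, ← mem_preimage, ← hF]; exact hp
  obtain ⟨l, -, hl⟩ := Finset.mem_image.1 hwp
  have hli : l = i := by
    by_contra hne
    exact hav l hne p hl.symm
  subst hli
  obtain ⟨q, hq⟩ : G.Nonempty := by rw [← Finset.card_pos, hGr.1]; exact hkpos
  have hwq : w q ∈ (Finset.univ.image y : Finset I) := by
    rw [← Finset.mem_coe, ← mem_preimage, ← hG]; exact hq
  obtain ⟨r, -, hr⟩ := Finset.mem_image.1 hwq
  have h1 : z j ≤ w q := hr ▸ hle.trans (hym.monotone (hi r))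
  have h2 : w p ≤ z j := hl ▸ (hzm hij).le
  obtain ⟨x, hx⟩ := mem_range_of_exists_le_of_exists_ge w.continuous ⟨p, h2⟩ ⟨q, h1⟩
  exact hav j hij.ne' x hx

/-- There are no nontrivial rigid sets. -/
lemma Rigid.vr_eq_zero (hν : ∀ x, ν {x} = 0) (hinv : LawInvariant m ν) (hinj : LawInjective m)
    (hleft : ∀ x : I, 0 < x → ∃ g ∈ m.support, g 0 = 0 ∧ g x < x) {Y : Finset I}
    (hY : Rigid m ν (alt Y id)) : vr ν (alt Y id) = 0 := by
  classical
  by_contra hne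
  have hex : ∃ k, ∃ Y : Finset I, Y.card = k ∧ Rigid m ν (alt Y id) ∧ 0 < vr ν (alt Y id) :=
    ⟨Y.card, Y, rfl, hY, (vr_nonneg _).lt_of_ne' hne⟩
  clear hne hY
  set k := Nat.find hex with hkdef
  obtain ⟨Y, hYc, hYr, hYv⟩ := Nat.find_spec hex
  rw [← hkdef] at hYc
  have hk : SwitchBound m ν k := fun Y' h1 h2 => Nat.find_min' hex ⟨Y', rfl, h1, h2⟩
  have hkpos : 0 < k := by
    rw [Nat.pos_iff_ne_zero]
    intro h0
    rw [h0, Finset.card_eq_zero] at hYc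
    subst hYc
    simp [vr] at hYv
  set c := vr ν (alt Y id) with hcdef
  have hYs : RigidSwitches m ν k c Y := ⟨hYc, hYr, rfl⟩
  obtain ⟨y₀, hy₀, -⟩ := hYs.exists_tuple
  set o : Fin k := ⟨0, hkpos⟩ with ho
  have hole : ∀ l, o ≤ l := fun l => Fin.mk_le_of_le_val (Nat.zero_le _)
  -- Extremal choice: the first switch is as far right as possible among rigid sets with `k`
  -- switches and variance `c`.
  obtain ⟨y, hy, hmax⟩ := (isCompact_rigidTuples (m := m) (c := c) (k := k) hν hinv).exists_isMaxOn
    ⟨y₀, hy₀⟩ (continuous_apply o).continuousOn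
  obtain ⟨hym, hyr⟩ := rigidSwitches_of_mem_rigidTuples hk hYv hy
  have hoy : y o ∈ (Finset.univ.image y : Finset I) :=
    Finset.mem_image_of_mem _ (Finset.mem_univ _)
  have hlow : ∀ v ∈ (Finset.univ.image y : Finset I), y o ≤ v := by
    intro v hv
    obtain ⟨l, -, rfl⟩ := Finset.mem_image.1 hv
    exact hym.monotone (hole l)
  obtain ⟨g, hg, hg0, hga⟩ := hleft (y o) (hyr.pos_of_mem hk hν hinv hYv hoy)
  have hae := hyr.ae_preimage hk hν hinv hinj hYv 1
  rw [compLaw_one] at hae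
  obtain ⟨w, ⟨hw0, hwa⟩, F, hF, hFr, -, -, heq⟩ := exists_mem_of_mem_support hg
    (U := {w : C(I, I) | w 0 < y o} ∩ {w : C(I, I) | w (y o) < y o})
    ((isOpen_lt (continuous_eval_const 0) continuous_const).inter
      (isOpen_lt (continuous_eval_const (y o)) continuous_const))
    ⟨by simpa [hg0] using hyr.pos_of_mem hk hν hinv hYv hoy, hga⟩ hae
  rw [mem_ofPred_eq] at hw0 hwa
  have hFmem : ∀ x, x ∈ F ↔ w x ∈ (Finset.univ.image y : Finset I) := fun x => by
    rw [← Finset.mem_coe, hF, mem_preimage, Finset.mem_coe]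
  obtain ⟨z, hz, hzm, rfl⟩ := hFr.exists_tuple
  have hpF : z o ∈ (Finset.univ.image z : Finset I) :=
    Finset.mem_image_of_mem _ (Finset.mem_univ _)
  -- Maximality gives `≤`. Equality is impossible since `w (y o)` lies below every switch in `y`,
  -- whereas `w (z o)` is one of them.
  have hpa : z o < y o := by
    refine lt_of_le_of_ne (hmax hz) fun h => ?_
    have := hlow _ ((hFmem _).1 hpF)
    rw [h] at this
    exact absurd hwa (not_lt.2 this)
  have hp0 : 0 < z o := hFr.pos_of_mem hk hν hinv hYv hpF
  have hrest : ∀ x ∈ (Finset.univ.image z : Finset I), x ≠ z o → y o < x := by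
    intro x hx hxp
    obtain ⟨l, -, rfl⟩ := Finset.mem_image.1 hx
    exact lt_of_mem_rigidTuples hk hν hinv hinj hYv hy hz
      (lt_of_le_of_ne (hole l) fun h => hxp (h ▸ rfl)) hole
  have hbelow := lt_of_touching hw0 hwa fun x hx hxp hxa =>
    (hx.trans (hrest x ((hFmem x).2 (hxa ▸ hoy)) hxp)).false.elim
  have hnot : ∀ x < y o, x ≠ z o → x ∉ w ⁻¹' alt (Finset.univ.image y) id := fun x hx hxp =>
    notMem_alt_of_forall_le fun v hv => (hbelow x hx hxp).le.trans (hlow v hv)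
  have hoff : ∀ x < y o, x ≠ z o → x ∉ (Finset.univ.image z : Finset I) := fun x hx hxp hxF =>
    (hx.trans (hrest x hxF hxp)).false
  have halt : ∀ x < y o, x ∈ alt (Finset.univ.image z) id ↔ z o < x := by
    intro x hx
    have h1 := mem_alt_insert (Finset.notMem_erase (z o) (Finset.univ.image z)) id x
    rw [Finset.insert_erase hpF] at h1
    have h2 : x ∉ alt ((Finset.univ.image z).erase (z o)) id :=
      notMem_alt_of_forall_le fun v hv =>
        (hx.trans (hrest v (Finset.mem_of_mem_erase hv) (Finset.ne_of_mem_erase hv))).le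
    rw [h1]
    simp only [id]
    tauto
  obtain ⟨x, hpx, hxa⟩ := exists_between hpa
  -- On `[0, y o)` away from `z o`, the preimage is empty, but `alt` changes at `z o`. A point just
  -- after `z o` refutes agreement, and the point `0` refutes agreement with the complement.
  rcases heq with h | h
  · exact hnot x hxa hpx.ne' ((h x (hoff x hxa hpx.ne')).2 ((halt x hxa).2 hpx))
  · have h0a : (0 : I) < y o := hp0.trans hpa
    refine hnot 0 h0a hp0.ne ((h 0 (hoff 0 h0a hp0.ne)).2 fun h0 => ?_)
    exact absurd ((halt 0 h0a).1 h0) (not_lt.2 unitInterval.nonneg')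

/-- The mean variance of `alt {x} id` tends to `0`. -/
lemma tendsto_meanVar (hν : ∀ x, ν {x} = 0) (hinv : LawInvariant m ν) (hinj : LawInjective m)
    (hleft : ∀ x : I, 0 < x → ∃ g ∈ m.support, g 0 = 0 ∧ g x < x) (x : I) :
    Tendsto (fun n => meanVar m ν n (Ioi x)) atTop (𝓝 0) := by
  have hIoi : alt {x} id = Ioi x := by
    ext z; rw [mem_alt_singleton]; rfl
  have hanti := meanVar_antitone (m := m) hinv (measurableSet_Ioi (a := x))
  have hbdd : BddBelow (range fun n => meanVar m ν n (Ioi x)) :=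
    ⟨0, by rintro _ ⟨n, rfl⟩; exact meanVar_nonneg n⟩
  have hlim := tendsto_atTop_ciInf hanti hbdd
  suffices h : ⨅ n, meanVar m ν n (Ioi x) = 0 by rwa [h] at hlim
  refine le_antisymm ?_ (le_ciInf fun n => meanVar_nonneg n)
  by_contra! hpos
  set δ := ⨅ n, meanVar m ν n (Ioi x)
  have hV : ∀ n, δ ≤ meanVar m ν n (alt {x} id) := fun n => by
    rw [hIoi]; exact ciInf_le hbdd n
  -- By Markov's inequality, more than `K` preimages occur with probability at most `1/K ≤ δ/2`.
  obtain ⟨K, hK⟩ := exists_nat_gt (2 / δ)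
  have hK0 : (0 : ℝ) < K := (by positivity : (0 : ℝ) < 2 / δ).trans hK
  obtain ⟨Y, -, hYr, hYv⟩ := exists_rigid hν hinv (K := K) hpos hV fun n => by
    have h1 : ((K : ℕ∞) : ℝ≥0∞) * compLaw m n {w : C(I, I) | ((K : ℕ∞) : ℝ≥0∞) ≤
        ((w ⁻¹' (({x} : Finset I) : Set I)).encard : ℝ≥0∞)} ≤ 1 :=
      (mul_meas_ge_le_lintegral (measurable_encard_preimage_finset {x}) _).trans
        (((hinj.compLaw n).lintegral_encard_le _).trans (by simp))
    have h2 : (K : ℝ) * (compLaw m n).real {w : C(I, I) | ((K : ℕ∞) : ℝ≥0∞) ≤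
        ((w ⁻¹' (({x} : Finset I) : Set I)).encard : ℝ≥0∞)} ≤ 1 := by
      have := ENNReal.toReal_mono ENNReal.one_ne_top h1
      simpa [ENNReal.toReal_mul, Measure.real] using this
    have h3 : (compLaw m n).real {w : C(I, I) | (K : ℕ∞) <
        (w ⁻¹' (({x} : Finset I) : Set I)).encard} ≤
        (compLaw m n).real {w : C(I, I) | ((K : ℕ∞) : ℝ≥0∞) ≤
        ((w ⁻¹' (({x} : Finset I) : Set I)).encard : ℝ≥0∞)} :=
      measureReal_mono fun w hw => by
        rw [mem_ofPred_eq] at hw ⊢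
        exact ENat.toENNReal_le.2 hw.le
    have h4 : 1 ≤ (K : ℝ) * (δ / 2) := by
      rw [div_lt_iff₀ hpos] at hK
      linarith
    exact h3.trans (le_of_mul_le_mul_left (h2.trans h4) hK0)
  exact hYv.ne' (hYr.vr_eq_zero hν hinv hinj hleft)

end Contradiction

/-! ### Convergence to a Dirac mass from tails -/

section WeakLimit

/-- By the portmanteau criterion only open `G` containing `θ` matter. Such a `G` contains an
interval around `θ`, so its complement lies in two vanishing tails; one of them is absent if `θ` is
an endpoint. -/
lemma tendsto_diracProba_of_tails {ρ : ℕ → ProbabilityMeasure I} {θ : I}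
    (hl : ∀ l < θ, ∃ d, l < d ∧ Tendsto (fun n => (ρ n : Measure I) (Iic d)) atTop (𝓝 0))
    (hr : ∀ u > θ, ∃ d, d < u ∧ Tendsto (fun n => (ρ n : Measure I) (Ioi d)) atTop (𝓝 0)) :
    Tendsto ρ atTop (𝓝 (diracProba θ)) := by
  refine tendsto_of_forall_isOpen_le_liminf' fun G hG => ?_
  by_cases hθ : θ ∈ G
  · have hleft : Tendsto (fun n => (ρ n : Measure I) (Gᶜ ∩ Iio θ)) atTop (𝓝 0) := by
      by_cases h0 : ∃ l, l < θ
      · obtain ⟨l, hlθ, hsub⟩ := exists_Ioc_subset_of_mem_nhds (hG.mem_nhds hθ) h0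
        obtain ⟨d, hld, hd⟩ := hl l hlθ
        refine tendsto_of_tendsto_of_tendsto_of_le_of_le tendsto_const_nhds hd (fun n => zero_le)
          fun n => measure_mono fun x hx => ?_
        by_contra hxd
        exact hx.1 (hsub ⟨hld.trans (not_le.1 hxd), hx.2.le⟩)
      · have : Gᶜ ∩ Iio θ = ∅ := by
          ext x
          simp only [mem_inter_iff, mem_Iio, mem_empty_iff_false, iff_false, not_and]
          exact fun _ hx => h0 ⟨x, hx⟩
        simp [this]
    have hright : Tendsto (fun n => (ρ n : Measure I) (Gᶜ ∩ Ioi θ)) atTop (𝓝 0) := by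
      by_cases h0 : ∃ u, θ < u
      · obtain ⟨u, hθu, hsub⟩ := exists_Ico_subset_of_mem_nhds (hG.mem_nhds hθ) h0
        obtain ⟨d, hdu, hd⟩ := hr u hθu
        refine tendsto_of_tendsto_of_tendsto_of_le_of_le tendsto_const_nhds hd (fun n => zero_le)
          fun n => measure_mono fun x hx => ?_
        by_contra hxd
        exact hx.1 (hsub ⟨hx.2.le, (not_lt.1 hxd).trans_lt hdu⟩)
      · have : Gᶜ ∩ Ioi θ = ∅ := by
          ext x
          simp only [mem_inter_iff, mem_Ioi, mem_empty_iff_false, iff_false, not_and]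
          exact fun _ hx => h0 ⟨x, hx⟩
        simp [this]
    have hcompl : Tendsto (fun n => (ρ n : Measure I) Gᶜ) atTop (𝓝 0) := by
      have hsum := hleft.add hright
      rw [add_zero] at hsum
      refine tendsto_of_tendsto_of_tendsto_of_le_of_le tendsto_const_nhds hsum (fun n => zero_le)
        fun n => (measure_mono fun x hx => ?_).trans (measure_union_le _ _)
      rcases lt_trichotomy x θ with h | h | h
      · exact Or.inl ⟨hx, h⟩
      · exact absurd (h ▸ hθ) hx
      · exact Or.inr ⟨hx, h⟩
    have hone : Tendsto (fun n => (ρ n : Measure I) G) atTop (𝓝 1) := by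
      have h1 := ENNReal.Tendsto.sub (tendsto_const_nhds (x := (1 : ℝ≥0∞)) (f := atTop)) hcompl
        (Or.inl ENNReal.one_ne_top)
      rw [tsub_zero] at h1
      refine h1.congr fun n => ?_
      rw [prob_compl_eq_one_sub hG.measurableSet, ENNReal.sub_sub_cancel ENNReal.one_ne_top
        prob_le_one]
    rw [hone.liminf_eq]
    exact prob_le_one
  · have : ((diracProba θ : ProbabilityMeasure I) : Measure I) G = 0 := by
      rw [diracProba]
      simp [Measure.dirac_apply' _ hG.measurableSet, hθ]
    rw [this]; exact zero_le

end WeakLimit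

/-! ### The random walk and its martingales -/

section Walk

open ProbabilityTheory

variable [MeasurableSpace C(I, I)] [BorelSpace C(I, I)] {Γ : Set C(I, I)} [MeasurableSpace Γ]
  [BorelSpace Γ] {μ : Measure Γ} [IsProbabilityMeasure μ]

/-- The events depending on the first `n` maps. -/
def pastFiltration (Γ : Set C(I, I)) [MeasurableSpace Γ] :
    Filtration ℕ (MeasurableSpace.pi : MeasurableSpace (ℕ → Γ)) where
  seq n := Filtration.piFinset (X := fun _ : ℕ => Γ) (Finset.range n)
  mono' _ _ h := Filtration.piFinset.mono (Finset.range_mono h)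
  le' _ := Filtration.piFinset.le _

lemma measurable_coe_subtype : Measurable (fun g : Γ => (g : C(I, I))) :=
  continuous_subtype_val.measurable

lemma measurable_eval_past {i n : ℕ} (h : i < n) :
    Measurable[pastFiltration Γ n] fun ω : ℕ → Γ => ω i := by
  have : (fun ω : ℕ → Γ => ω i) =
      (fun v : Finset.range n → Γ => v ⟨i, Finset.mem_range.2 h⟩) ∘ (Finset.range n).restrict := rfl
  rw [this]
  exact (measurable_pi_apply _).comp (comap_measurable _)

lemma measurable_rightWalk_past (n : ℕ) :
    Measurable[pastFiltration Γ n] fun ω : ℕ → Γ => rightWalk ω n := by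
  induction n with
  | zero => exact measurable_const
  | succ n ih =>
    have h1 : Measurable[pastFiltration Γ (n + 1)] fun ω : ℕ → Γ => rightWalk ω n :=
      ih.mono ((pastFiltration Γ).mono (Nat.le_succ n)) le_rfl
    have h2 : Measurable[pastFiltration Γ (n + 1)] fun ω : ℕ → Γ => (ω n : C(I, I)) :=
      measurable_coe_subtype.comp (measurable_eval_past (Nat.lt_succ_self n))
    exact measurable_comp_prod.comp (h1.prodMk h2)

lemma measurable_rightWalk (n : ℕ) : Measurable fun ω : ℕ → Γ => rightWalk ω n :=
  (measurable_rightWalk_past n).mono ((pastFiltration Γ).le n) le_rfl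

/-- Independence of the next map from any quantity `ξ` determined by the first `n` maps, stated as a
product law so that Fubini applies. -/
lemma map_past_prod {T : Type*} [MeasurableSpace T] {n : ℕ} {ξ : (ℕ → Γ) → T}
    (hξ : Measurable[pastFiltration Γ n] ξ) :
    (Measure.infinitePi fun _ : ℕ => μ).map (fun ω => (ξ ω, (ω n : C(I, I)))) =
      ((Measure.infinitePi fun _ : ℕ => μ).map ξ).prod (μ.map (fun g : Γ => (g : C(I, I)))) := by
  have hξ' : Measurable ξ := hξ.mono ((pastFiltration Γ).le n) le_rfl
  have hind : IndepFun (fun (ω : ℕ → Γ) (i : Finset.range n) => ω i)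
      (fun (ω : ℕ → Γ) (i : ({n} : Finset ℕ)) => ω i) (Measure.infinitePi fun _ : ℕ => μ) :=
    (iIndepFun_infinitePi (P := fun _ : ℕ => μ) (X := fun _ x => x)
      fun _ => measurable_id).indepFun_finset _ _ (by simp) fun i => measurable_pi_apply i
  have hind2 : IndepFun (fun (ω : ℕ → Γ) (i : Finset.range n) => ω i)
      (fun ω : ℕ → Γ => (ω n : C(I, I))) (Measure.infinitePi fun _ : ℕ => μ) :=
    hind.comp (φ := id) (ψ := fun v : ({n} : Finset ℕ) → Γ => (v ⟨n, by simp⟩ : C(I, I)))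
      measurable_id (measurable_coe_subtype.comp (measurable_pi_apply _))
  have hind3 : IndepFun ξ (fun ω : ℕ → Γ => (ω n : C(I, I)))
      (Measure.infinitePi fun _ : ℕ => μ) := by
    rw [IndepFun_iff_Indep] at hind2 ⊢
    exact indep_of_indep_of_le_left hind2 hξ.comap_le
  have hcoe : Measurable fun ω : ℕ → Γ => (ω n : C(I, I)) :=
    measurable_coe_subtype.comp (measurable_pi_apply n)
  rw [(indepFun_iff_map_prod_eq_prod_map_map hξ'.aemeasurable hcoe.aemeasurable).1 hind3]
  congr 1
  conv_rhs => rw [← Measure.infinitePi_map_eval (fun _ : ℕ => μ) n]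
  rw [Measure.map_map measurable_coe_subtype (measurable_pi_apply n)]
  rfl

instance isProbabilityMeasure_map_coe :
    IsProbabilityMeasure (μ.map (fun g : Γ => (g : C(I, I)))) :=
  Measure.isProbabilityMeasure_map measurable_coe_subtype.aemeasurable

lemma map_rightWalk (n : ℕ) :
    (Measure.infinitePi fun _ : ℕ => μ).map (fun ω => rightWalk ω n) =
      compLaw (μ.map (fun g : Γ => (g : C(I, I)))) n := by
  induction n with
  | zero => simp [compLaw, rightWalk, Measure.map_const]
  | succ n ih =>
    have hcoe : Measurable fun ω : ℕ → Γ => (ω n : C(I, I)) :=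
      measurable_coe_subtype.comp (measurable_pi_apply n)
    rw [compLaw, ← ih, ← map_past_prod (measurable_rightWalk_past n),
      Measure.map_map measurable_comp_prod ((measurable_rightWalk n).prodMk hcoe)]
    rfl

variable {ν : Measure I} [IsProbabilityMeasure ν]

/-- Conditionally on `w`, the mean of `ν(g⁻¹(w⁻¹A))` over the next map is `ν(w⁻¹A)` by invariance.
The process is thus a martingale; the submartingale form is what the convergence theorem takes. -/
lemma submartingale_measureReal (hinv : LawInvariant (μ.map (fun g : Γ => (g : C(I, I)))) ν)
    {A : Set I} (hA : MeasurableSet A) :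
    Submartingale (fun n (ω : ℕ → Γ) => ν.real (rightWalk ω n ⁻¹' A)) (pastFiltration Γ)
      (Measure.infinitePi fun _ : ℕ => μ) := by
  have hmeas := measurable_measureReal_preimage (ν := ν) hA
  refine submartingale_of_setIntegral_le_succ
    (fun n => (hmeas.comp (measurable_rightWalk_past n)).stronglyMeasurable)
    (fun n => Integrable.of_bound
      (hmeas.comp (measurable_rightWalk n)).aestronglyMeasurable 1 (ae_of_all _ fun ω => by
        rw [Real.norm_of_nonneg measureReal_nonneg]; exact measureReal_le_one))
    fun n S hS => le_of_eq ?_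
  have hS' : MeasurableSet S := (pastFiltration Γ).le n S hS
  -- Recording the indicator of the past event `S` along with the walk turns the conditional
  -- statement into one integral over a product.
  let ξ : (ℕ → Γ) → ℝ × C(I, I) := fun ω => (S.indicator 1 ω, rightWalk ω n)
  have hξ : Measurable[pastFiltration Γ n] ξ :=
    (Measurable.indicator (@measurable_const _ _ _ (pastFiltration Γ n) 1) hS).prodMk (measurable_rightWalk_past n)
  have hξ' : Measurable ξ := hξ.mono ((pastFiltration Γ).le n) le_rfl
  have hcoe : Measurable fun ω : ℕ → Γ => (ω n : C(I, I)) :=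
    measurable_coe_subtype.comp (measurable_pi_apply n)
  let m := μ.map (fun g : Γ => (g : C(I, I)))
  let H : (ℝ × C(I, I)) × C(I, I) → ℝ :=
    fun p => p.1.1 * ν.real ((p.1.2.comp p.2) ⁻¹' A)
  have hH : Measurable H := measurable_fst.fst.mul
    (hmeas.comp (measurable_comp_prod.comp (measurable_fst.snd.prodMk measurable_snd)))
  have e1 : ∀ k, ∫ ω in S, ν.real (rightWalk ω k ⁻¹' A) ∂(Measure.infinitePi fun _ : ℕ => μ) =
      ∫ ω, S.indicator 1 ω * ν.real (rightWalk ω k ⁻¹' A) ∂(Measure.infinitePi fun _ : ℕ => μ) := by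
    intro k
    rw [← integral_indicator hS']
    refine integral_congr_ae (ae_of_all _ fun ω => ?_)
    by_cases h : ω ∈ S <;> simp [h]
  have hHint : Integrable H (((Measure.infinitePi fun _ : ℕ => μ).map ξ).prod m) := by
    rw [← map_past_prod hξ, integrable_map_measure hH.aestronglyMeasurable
      (hξ'.prodMk hcoe).aemeasurable]
    refine Integrable.of_bound (hH.comp (hξ'.prodMk hcoe)).aestronglyMeasurable 1
      (ae_of_all _ fun ω => ?_)
    simp only [Function.comp, H, ξ, norm_mul]
    rw [Real.norm_of_nonneg measureReal_nonneg]
    refine mul_le_one₀ ?_ measureReal_nonneg measureReal_le_one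
    by_cases h : ω ∈ S <;> simp [h]
  have e2 : ∫ ω, S.indicator 1 ω * ν.real (rightWalk ω (n + 1) ⁻¹' A)
      ∂(Measure.infinitePi fun _ : ℕ => μ) = ∫ p, H p
        ∂(((Measure.infinitePi fun _ : ℕ => μ).map ξ).prod m) := by
    rw [← map_past_prod hξ, integral_map (hξ'.prodMk hcoe).aemeasurable hH.aestronglyMeasurable]
    rfl
  rw [e1, e1, e2, integral_prod _ hHint, integral_map hξ'.aemeasurable
    hHint.aestronglyMeasurable.integral_prod_right']
  refine integral_congr_ae (ae_of_all _ fun ω => ?_)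
  simp only [H, ξ]
  rw [integral_const_mul]
  congr 1
  exact (hinv.integral_measureReal ((rightWalk ω n).continuous.measurable hA)).symm

/-- The bounded martingale has a limit `L`. By dominated convergence the mean of `L(1 - L)` is the
limit of the mean variances, namely `0`, and `L(1 - L) ≥ 0`. -/
lemma ae_tendsto_zero_or_one (hinv : LawInvariant (μ.map (fun g : Γ => (g : C(I, I)))) ν)
    {A : Set I} (hA : MeasurableSet A)
    (h0 : Tendsto (fun n => meanVar (μ.map (fun g : Γ => (g : C(I, I)))) ν n A) atTop (𝓝 0)) :
    ∀ᵐ ω ∂(Measure.infinitePi fun _ : ℕ => μ),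
      Tendsto (fun n => ν.real (rightWalk ω n ⁻¹' A)) atTop (𝓝 0) ∨
      Tendsto (fun n => ν.real (rightWalk ω n ⁻¹' A)) atTop (𝓝 1) := by
  have hsub := submartingale_measureReal hinv hA
  have hbd : ∀ n, eLpNorm (fun ω : ℕ → Γ => ν.real (rightWalk ω n ⁻¹' A)) 1
      (Measure.infinitePi fun _ : ℕ => μ) ≤ (1 : NNReal) := by
    intro n
    refine (eLpNorm_le_of_ae_bound (C := 1) (ae_of_all _ fun ω => ?_)).trans (by simp)
    rw [Real.norm_of_nonneg measureReal_nonneg]; exact measureReal_le_one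
  set L := fun ω : ℕ → Γ => limUnder atTop fun n => ν.real (rightWalk ω n ⁻¹' A) with hL
  have hlim : ∀ᵐ ω ∂(Measure.infinitePi fun _ : ℕ => μ),
      Tendsto (fun n => ν.real (rightWalk ω n ⁻¹' A)) atTop (𝓝 (L ω)) :=
    (hsub.exists_ae_tendsto_of_bdd hbd).mono fun ω hω => tendsto_nhds_limUnder hω
  have hvm : ∀ n, Measurable fun ω : ℕ → Γ => vr ν (rightWalk ω n ⁻¹' A) := fun n =>
    (measurable_vr_preimage hA).comp (measurable_rightWalk n)
  have hvlim : ∀ᵐ ω ∂(Measure.infinitePi fun _ : ℕ => μ),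
      Tendsto (fun n => vr ν (rightWalk ω n ⁻¹' A)) atTop (𝓝 (L ω * (1 - L ω))) :=
    hlim.mono fun ω hω => hω.mul (tendsto_const_nhds.sub hω)
  have hint := tendsto_integral_of_dominated_convergence (fun _ => (1 : ℝ))
    (fun n => (hvm n).aestronglyMeasurable) (integrable_const 1)
    (fun n => ae_of_all _ fun ω => norm_vr_le _) hvlim
  have hmv : ∀ n, ∫ ω, vr ν (rightWalk ω n ⁻¹' A) ∂(Measure.infinitePi fun _ : ℕ => μ) =
      meanVar (μ.map (fun g : Γ => (g : C(I, I)))) ν n A := by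
    intro n
    rw [meanVar, ← map_rightWalk, integral_map (measurable_rightWalk n).aemeasurable
      (measurable_vr_preimage hA).aestronglyMeasurable]
  simp_rw [hmv] at hint
  have hzero := tendsto_nhds_unique hint h0
  have hbound : ∀ᵐ ω ∂(Measure.infinitePi fun _ : ℕ => μ), 0 ≤ L ω * (1 - L ω) ∧
      ‖L ω * (1 - L ω)‖ ≤ 1 := by
    filter_upwards [hvlim] with ω hω
    exact ⟨ge_of_tendsto' hω fun n => vr_nonneg _, le_of_tendsto' hω.norm fun n => norm_vr_le _⟩
  have hLint : Integrable (fun ω => L ω * (1 - L ω)) (Measure.infinitePi fun _ : ℕ => μ) :=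
    Integrable.of_bound (aestronglyMeasurable_of_tendsto_ae atTop
      (fun n => (hvm n).aestronglyMeasurable) hvlim) 1 (hbound.mono fun ω hω => hω.2)
  rw [integral_eq_zero_iff_of_nonneg_ae (hbound.mono fun ω hω => hω.1) hLint] at hzero
  filter_upwards [hlim, hzero] with ω hω hz
  rcases mul_eq_zero.1 hz with h | h
  · left; rwa [h] at hω
  · right; rwa [← sub_eq_zero.1 h] at hω

end Walk

/-! ### From zero-one tails to proximality -/

/-- If the tail functions of `ρ n` at the points of a dense sequence converge to `0` or `1`, then
`ρ n` converges to a Dirac mass. -/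
lemma tendsto_diracProba_iSup {ρ : ℕ → ProbabilityMeasure I} {d : ℕ → I} (hd : DenseRange d)
    (h : ∀ k, Tendsto (fun n => (ρ n : Measure I).real (Ioi (d k))) atTop (𝓝 0) ∨
      Tendsto (fun n => (ρ n : Measure I).real (Ioi (d k))) atTop (𝓝 1)) :
    Tendsto ρ atTop (𝓝 (diracProba (⨆ k, if 1 / 2 <
      limsup (fun n => (ρ n : Measure I).real (Ioi (d k))) atTop then d k else 0))) := by
  -- The limit point is the supremum of the `d k` whose tails carry mass tending to `1`. The
  -- `limsup` is a measurable expression for the limit, `1/2` separates the two possible values, and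
  -- the default `0` does not affect the supremum.
  set e : ℕ → I := fun k => if 1 / 2 <
      limsup (fun n => (ρ n : Measure I).real (Ioi (d k))) atTop then d k else 0 with he
  refine tendsto_diracProba_of_tails (fun l hl => ?_) fun u hu => ?_
  · obtain ⟨k, hk⟩ := lt_iSup_iff.1 hl
    have hlim : 1 / 2 < limsup (fun n => (ρ n : Measure I).real (Ioi (d k))) atTop := by
      by_contra hcon
      simp only [he, if_neg hcon] at hk
      exact absurd hk (not_lt.2 unitInterval.nonneg')
    simp only [he, if_pos hlim] at hk
    refine ⟨d k, hk, ?_⟩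
    have h1 : Tendsto (fun n => (ρ n : Measure I).real (Ioi (d k))) atTop (𝓝 1) := by
      refine (h k).resolve_left fun h0 => ?_
      rw [h0.limsup_eq] at hlim
      norm_num at hlim
    have h2 := (tendsto_const_nhds (x := (1 : ℝ)) (f := atTop)).sub h1
    rw [sub_self] at h2
    rw [← ENNReal.tendsto_toReal_iff (fun n => measure_ne_top _ _) ENNReal.zero_ne_top]
    refine h2.congr fun n => ?_
    rw [← probReal_compl_eq_one_sub measurableSet_Ioi, compl_Ioi]
    rfl
  · obtain ⟨_, ⟨k, rfl⟩, hk1, hk2⟩ := hd.exists_between hu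
    refine ⟨d k, hk2, ?_⟩
    rw [← ENNReal.tendsto_toReal_iff (fun n => measure_ne_top _ _) ENNReal.zero_ne_top]
    refine (h k).resolve_right fun h1 => ?_
    refine absurd hk1 (not_lt.2 ?_)
    have : e k = d k := by
      simp only [he]
      rw [if_pos (by rw [h1.limsup_eq]; norm_num)]
    exact this ▸ le_iSup e k

variable [MeasurableSpace C(I, I)] [BorelSpace C(I, I)] {Γ : Set C(I, I)} [MeasurableSpace Γ]
  [BorelSpace Γ] {μ : Measure Γ} [IsProbabilityMeasure μ]

lemma walkImage_apply (ν : ProbabilityMeasure I) (ω : ℕ → Γ) (n : ℕ) {A : Set I}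
    (hA : MeasurableSet A) :
    (walkImage ν ω n : Measure I).real A = (ν : Measure I).real (rightWalk ω n ⁻¹' A) := by
  rw [walkImage, ProbabilityMeasure.toMeasure_map,
    map_measureReal_apply (rightWalk ω n).continuous.measurable hA]

lemma isProximal_of_tendsto_meanVar {ν : ProbabilityMeasure I}
    (hinv : LawInvariant (μ.map (fun g : Γ => (g : C(I, I)))) ν)
    (h : ∀ x, Tendsto (fun n => meanVar (μ.map (fun g : Γ => (g : C(I, I)))) ν n (Ioi x))
      atTop (𝓝 0)) : IsProximal μ ν := by
  let d := TopologicalSpace.denseSeq I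
  refine ⟨fun ω => ⨆ k, if 1 / 2 <
      limsup (fun n => (walkImage ν ω n : Measure I).real (Ioi (d k))) atTop then d k else 0,
    ?_, ?_⟩
  · refine Measurable.iSup fun k => Measurable.ite (measurableSet_lt measurable_const ?_)
      measurable_const measurable_const
    refine Measurable.limsup fun n => ?_
    simp_rw [walkImage_apply ν _ n measurableSet_Ioi]
    exact (measurable_measureReal_preimage measurableSet_Ioi).comp (measurable_rightWalk n)
  · have hae := ae_all_iff.2 fun k =>
      ae_tendsto_zero_or_one hinv (measurableSet_Ioi (a := d k)) (h (d k))
    filter_upwards [hae] with ω hω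
    refine tendsto_diracProba_iSup (TopologicalSpace.denseRange_denseSeq I) fun k => ?_
    simp_rw [walkImage_apply ν ω _ measurableSet_Ioi]
    exact hω k

lemma coe_mem_support (hsupp : μ.support = univ) {g : C(I, I)} (hg : g ∈ Γ) :
    g ∈ (μ.map (fun g : Γ => (g : C(I, I)))).support := by
  rw [Measure.mem_support_iff_forall]
  intro U hU
  have h : (⟨g, hg⟩ : Γ) ∈ μ.support := hsupp ▸ mem_univ _
  rw [Measure.mem_support_iff_forall] at h
  exact (h _ (continuous_subtype_val.continuousAt.preimage_mem_nhds hU)).trans_le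
    (Measure.le_map_apply measurable_coe_subtype.aemeasurable U)

lemma IsInvariant.lawInvariant {ν : Measure I} [SFinite ν] (h : IsInvariant μ ν) :
    LawInvariant (μ.map (fun g : Γ => (g : C(I, I)))) ν := by
  intro A hA
  rw [lintegral_map (measurable_measure_preimage ν hA) measurable_coe_subtype]
  exact h A hA

lemma IsMuInjective.lawInjective (h : IsMuInjective μ) :
    LawInjective (μ.map (fun g : Γ => (g : C(I, I)))) := by
  intro x
  rw [lintegral_map (measurable_preimageCount x) measurable_coe_subtype]
  exact h x

lemma isProximal_of_conditionA (hA : ConditionA Γ) (hsupp : μ.support = univ)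
    (hinj : IsMuInjective μ) {ν : ProbabilityMeasure I} (hν : IsInvariant μ ν) :
    IsProximal μ ν := by
  have hinv := hν.lawInvariant
  have hinj' := hinj.lawInjective
  have hatom : ∀ x, (ν : Measure I) {x} = 0 := by
    refine hinv.measure_singleton_eq_zero hinj' (fun x hx => ?_) ?_
    · obtain ⟨g, hg, -, hg1, hg2⟩ := hA.1 x ⟨hx, unitInterval.le_one'⟩
      exact ⟨g, coe_mem_support hsupp hg, hg1, hg2⟩
    · obtain ⟨h, hh, -, hh1, -⟩ := hA.2 0 ⟨le_rfl, zero_lt_one⟩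
      exact ⟨h, coe_mem_support hsupp hh, hh1⟩
  refine isProximal_of_tendsto_meanVar hinv fun x => tendsto_meanVar hatom hinv hinj' ?_ x
  intro x hx
  obtain ⟨g, hg, hg0, -, hg2⟩ := hA.1 x ⟨hx, unitInterval.le_one'⟩
  exact ⟨g, coe_mem_support hsupp hg, hg0, hg2⟩

end IntervalSystem

theorem theorem4p6 (Γ : Set C(I, I)) [MeasurableSpace Γ] [BorelSpace Γ]
    (hΓ : ∀ g ∈ Γ, IntervalSystem.PiecewiseMonotone g)
    (hA : IntervalSystem.ConditionA Γ)
    (μ : Measure Γ) [IsProbabilityMeasure μ]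
    (hsupp : μ.support = Set.univ)
    (hinj : IntervalSystem.IsMuInjective μ)
    (hdiag : IntervalSystem.BelowDiagonalLeft μ ∨ IntervalSystem.AboveDiagonalRight μ)
    (ν : ProbabilityMeasure I)
    (hν : IntervalSystem.IsInvariant μ ν) :
    IntervalSystem.IsProximal μ ν := by
  -- Compositions need not stay in `Γ`, so their laws are taken on all of `C(I, I)` with its Borel
  -- structure.
  let _ : MeasurableSpace C(I, I) := borel _
  have : BorelSpace C(I, I) := ⟨rfl⟩
  exact IntervalSystem.isProximal_of_conditionA hA hsupp hinj hν
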